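/- Notation. "For small $\varepsilon$" means for all $\varepsilon\in(0,\varepsilon_0]$, for some $\varepsilon_0\in(0,1]$. For an open set $\Omega\subseteq\mathbb R^d$, $\mathcal D(\Omega)$ is the space of smooth, compactly supported functions $\Omega\to\mathbb C$, and $\mathbb R^+=(0,\infty)$. A net $(u_\varepsilon)_{\varepsilon\in(0,1]}$ of smooth functions $\Omega\to\mathbb C$ is called moderate if for each compact $K\subset\Omega$ and each multi-index $\beta$ there is $N\in\mathbb N$ such that $\sup_K|\partial^\beta u_\varepsilon|\le\varepsilon^{-N}$ for small $\varepsilon$, and negligible if for each compact $K\subset\Omega$, each $\beta$ and each $m\in\mathbb N$, $\sup_K|\partial^\beta u_\varepsilon|\le\varepsilon^{m}$ for small $\varepsilon$. The special Colombeau algebra $\mathcal G(\Omega)$ is the algebra of moderate nets modulo the ideal of negligible nets. The ring $\widetilde{\mathbb C}$ of generalized constants is defined in the same way from nets of complex numbers. For $f=[(f_\varepsilon)_\varepsilon]\in\mathcal G(\Omega)$ and $\phi\in\mathcal D(\Omega)$, $\int f\phi:=[(\int_\Omega f_\varepsilon\phi)_\varepsilon]\in\widetilde{\mathbb C}$; $f,g\in\mathcal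 G(\Omega)$ are equal in the sense of generalized distributions if $\int f\phi=\int g\phi$ for all $\phi\in\mathcal D(\Omega)$. Let $\alpha\in\mathbb R$. An element $f\in\mathcal G(\mathbb R^d\setminus\{0\})$ is strongly homogeneous of degree $\alpha$ if $f(\lambda\,\cdot)=\lambda^\alpha f$ in $\mathcal G(\mathbb R^d\setminus\{0\})$ for each real $\lambda>0$, and weakly homogeneous of degree $\alpha$ if $\int f(\lambda x)\phi(x)\,dx=\int\lambda^\alpha f(x)\phi(x)\,dx$ in $\widetilde{\mathbb C}$ for each real $\lambda>0$ and each $\phi\in\mathcal D(\mathbb R^d\setminus\{0\})$. Theorem. Let $\alpha\in\mathbb R$ and let $f\in\mathcal G(\mathbb R^d\setminus\{0\})$ be weakly homogeneous of degree $\alpha$. Let $u_0\in\mathcal D(\mathbb R^+)$ with $\int u_0=1$. Let $g\in\mathcal G(\mathbb R^d\setminus\{0\})$ be the radial mean $$g(x)=\int_{\mathbb R^+}\frac{f(rx)}{r^\alpha}\,u_0(r)\,dr,$$ defined on representatives. Then $$\int_{\mathbb R^d} f(x)\phi(x)\,dx=\int_{\mathbb R^d} g\Big(\frac{x}{|x|}\Big)|x|^\alpha\phi(x)\,dx\quad\text{in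 }\widetilde{\mathbb C},\qquad\text{for all }\phi\in\mathcal D(\mathbb R^d\setminus\{0\}).$$ In particular, $f$ is equal in the sense of generalized distributions to a strongly homogeneous generalized function of degree $\alpha$ in $\mathcal G(\mathbb R^d\setminus\{0\})$. -/

import Mathlib

open Set Filter Topology MeasureTheory TopologicalSpace
open scoped ContDiff Distributions

noncomputable section

namespace Colombeau

/-- The parameter set `(0, 1]`. -/
abbrev Idx : Type := Set.Ioc (0 : ℝ) 1

/-- The filter expressing "for small `ε`" on `(0, 1]`. -/
def smallEps : Filter Idx := comap (fun ε : Idx => (ε : ℝ)) (𝓝 0)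

/-- Euclidean space of dimension `d`. -/
abbrev Rd (d : ℕ) : Type := EuclideanSpace ℝ (Fin d)

section Growth

variable {X : Type*} {K : Set X} {F G : Idx → X → ℝ}

/-- Uniform moderate growth of a net of real functions on a set. -/
def UMod (K : Set X) (F : Idx → X → ℝ) : Prop :=
  ∃ N : ℕ, ∀ᶠ ε in smallEps, ∀ x ∈ K, F ε x ≤ ((ε : ℝ)⁻¹) ^ N

/-- Uniform rapid decay of a net of real functions on a set. -/
def UNeg (K : Set X) (F : Idx → X → ℝ) : Prop :=
  ∀ m : ℕ, ∀ᶠ ε in smallEps, ∀ x ∈ K, F ε x ≤ (ε : ℝ) ^ m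

lemma eventually_le_smallEps {c : ℝ} (hc : 0 < c) : ∀ᶠ ε : Idx in smallEps, (ε : ℝ) ≤ c :=
  (tendsto_comap (f := fun ε : Idx => (ε : ℝ))).eventually (eventually_le_nhds hc)

lemma one_le_inv_idx (ε : Idx) : 1 ≤ (ε : ℝ)⁻¹ := (one_le_inv₀ ε.2.1).2 ε.2.2

lemma UMod.of_const_mul (C : ℝ) (N : ℕ)
    (h : ∀ᶠ ε in smallEps, ∀ x ∈ K, F ε x ≤ C * ((ε : ℝ)⁻¹) ^ N) : UMod K F := by
  refine ⟨N + 1, ?_⟩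
  filter_upwards [h, eventually_le_smallEps (c := (max C 1)⁻¹) (by positivity)] with ε h1 h2 x hx
  refine (h1 x hx).trans ?_
  have hC : C ≤ (ε : ℝ)⁻¹ :=
    (le_max_left C 1).trans ((le_inv_comm₀ ε.2.1 (by positivity)).1 h2)
  rw [pow_succ']
  have := one_le_inv_idx ε
  gcongr

lemma UNeg.of_const_mul
    (h : ∀ m : ℕ, ∃ C : ℝ, ∀ᶠ ε in smallEps, ∀ x ∈ K, F ε x ≤ C * (ε : ℝ) ^ m) : UNeg K F := by
  intro m
  obtain ⟨C, hC⟩ := h (m + 1)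
  filter_upwards [hC, eventually_le_smallEps (c := (max C 1)⁻¹) (by positivity)] with ε h1 h2 x hx
  refine (h1 x hx).trans ?_
  have hε : (0 : ℝ) < ε := ε.2.1
  have h3 : max C 1 * (ε : ℝ) ≤ 1 := by
    have hM : 0 < max C 1 := by positivity
    calc max C 1 * (ε : ℝ) ≤ max C 1 * (max C 1)⁻¹ := by gcongr
      _ = 1 := mul_inv_cancel₀ hM.ne'
  calc C * (ε : ℝ) ^ (m + 1) ≤ max C 1 * (ε : ℝ) ^ (m + 1) := by gcongr; exact le_max_left _ _
    _ = (max C 1 * ε) * (ε : ℝ) ^ m := by ring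
    _ ≤ 1 * (ε : ℝ) ^ m := by gcongr
    _ = _ := one_mul _

lemma UMod.mono (hG : UMod K G) (h : ∀ ε, ∀ x ∈ K, F ε x ≤ G ε x) : UMod K F := by
  obtain ⟨N, hN⟩ := hG
  exact ⟨N, hN.mono fun ε h1 x hx => (h ε x hx).trans (h1 x hx)⟩

lemma UNeg.mono (hG : UNeg K G) (h : ∀ ε, ∀ x ∈ K, F ε x ≤ G ε x) : UNeg K F :=
  fun m => (hG m).mono fun ε h1 x hx => (h ε x hx).trans (h1 x hx)

lemma UMod.const (C : ℝ) : UMod K (fun _ _ => C) :=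
  UMod.of_const_mul C 0 (by simp)

lemma UMod.add (hF : UMod K F) (hG : UMod K G) : UMod K (fun ε x => F ε x + G ε x) := by
  obtain ⟨N, hN⟩ := hF
  obtain ⟨M, hM⟩ := hG
  refine UMod.of_const_mul 2 (N + M) ?_
  filter_upwards [hN, hM] with ε h1 h2 x hx
  have h := one_le_inv_idx ε
  have a := pow_le_pow_right₀ h (Nat.le_add_right N M)
  have b := pow_le_pow_right₀ h (Nat.le_add_left M N)
  linarith [h1 x hx, h2 x hx]

lemma UNeg.add (hF : UNeg K F) (hG : UNeg K G) : UNeg K (fun ε x => F ε x + G ε x) := by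
  refine UNeg.of_const_mul fun m => ⟨2, ?_⟩
  filter_upwards [hF m, hG m] with ε h1 h2 x hx
  linarith [h1 x hx, h2 x hx]

lemma UMod.mul (hF : UMod K F) (hG : UMod K G) (h0 : ∀ ε x, 0 ≤ G ε x) :
    UMod K (fun ε x => F ε x * G ε x) := by
  obtain ⟨N, hN⟩ := hF
  obtain ⟨M, hM⟩ := hG
  refine ⟨N + M, ?_⟩
  filter_upwards [hN, hM] with ε h1 h2 x hx
  have h := one_le_inv_idx ε
  rw [pow_add]
  exact mul_le_mul (h1 x hx) (h2 x hx) (h0 ε x) (by positivity)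

lemma UMod.mul_neg (hF : UMod K F) (hG : UNeg K G) (h0 : ∀ ε x, 0 ≤ G ε x) :
    UNeg K (fun ε x => F ε x * G ε x) := by
  obtain ⟨N, hN⟩ := hF
  intro m
  filter_upwards [hN, hG (N + m)] with ε h1 h2 x hx
  have hε : (0 : ℝ) < ε := ε.2.1
  have h := one_le_inv_idx ε
  refine (mul_le_mul (h1 x hx) (h2 x hx) (h0 ε x) (by positivity)).trans (le_of_eq ?_)
  rw [pow_add, ← mul_assoc, ← mul_pow, inv_mul_cancel₀ hε.ne', one_pow, one_mul]

lemma UNeg.zero : UNeg K (fun _ _ => 0) := fun m =>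
  Eventually.of_forall fun ε _ _ => pow_nonneg ε.2.1.le m

lemma UMod.sum {ι : Type*} (s : Finset ι) {F : ι → Idx → X → ℝ} (h : ∀ i ∈ s, UMod K (F i)) :
    UMod K (fun ε x => ∑ i ∈ s, F i ε x) := by
  classical
  induction s using Finset.induction_on with
  | empty => simpa using UMod.const 0
  | insert a s ha ih =>
    simp only [Finset.sum_insert ha]
    exact (h a (by simp)).add (ih fun i hi => h i (by simp [hi]))

lemma UNeg.sum {ι : Type*} (s : Finset ι) {F : ι → Idx → X → ℝ} (h : ∀ i ∈ s, UNeg K (F i)) :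
    UNeg K (fun ε x => ∑ i ∈ s, F i ε x) := by
  classical
  induction s using Finset.induction_on with
  | empty => simpa using UNeg.zero
  | insert a s ha ih =>
    simp only [Finset.sum_insert ha]
    exact (h a (by simp)).add (ih fun i hi => h i (by simp [hi]))

end Growth

/-! ### Generalized constants -/

/-- The algebra of moderate nets of complex numbers. -/
def moderateConst : Subalgebra ℂ (Idx → ℂ) where
  carrier := {c | ∃ N : ℕ, ∀ᶠ ε in smallEps, ‖c ε‖ ≤ ((ε : ℝ)⁻¹) ^ N}
  mul_mem' {a b} ha hb := by
    have h : UMod (univ : Set Unit) (fun ε _ => ‖a ε‖ * ‖b ε‖) :=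
      UMod.mul (by simpa [UMod] using ha) (by simpa [UMod] using hb) fun _ _ => norm_nonneg _
    simpa [UMod] using h
  add_mem' {a b} ha hb := by
    have h : UMod (univ : Set Unit) (fun ε _ => ‖a ε + b ε‖) :=
      (UMod.add (F := fun ε _ => ‖a ε‖) (G := fun ε _ => ‖b ε‖)
        (by simpa [UMod] using ha) (by simpa [UMod] using hb)).mono
        fun _ _ _ => norm_add_le _ _
    simpa [UMod] using h
  algebraMap_mem' r := by
    have h : UMod (univ : Set Unit) (fun _ _ => ‖r‖) := UMod.const _
    simpa [UMod] using h

lemma uMod_of_mem {c : Idx → ℂ} (h : c ∈ moderateConst) :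
    UMod (univ : Set Unit) (fun ε _ => ‖c ε‖) := by
  obtain ⟨N, hN⟩ := h
  exact ⟨N, hN.mono fun _ h _ _ => h⟩

lemma mem_of_uMod {c : Idx → ℂ} (h : UMod (univ : Set Unit) (fun ε _ => ‖c ε‖)) :
    c ∈ moderateConst := by
  obtain ⟨N, hN⟩ := h
  exact ⟨N, hN.mono fun _ h => h () trivial⟩

/-- The ideal of negligible nets of complex numbers. -/
def negligibleConst : Ideal moderateConst where
  carrier := {c | ∀ m : ℕ, ∀ᶠ ε in smallEps, ‖c.1 ε‖ ≤ (ε : ℝ) ^ m}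
  add_mem' {a b} ha hb := by
    have h : UNeg (univ : Set Unit) (fun ε _ => ‖a.1 ε + b.1 ε‖) :=
      (UNeg.add (F := fun ε _ => ‖a.1 ε‖) (G := fun ε _ => ‖b.1 ε‖)
        (by simpa [UNeg] using ha) (by simpa [UNeg] using hb)).mono
        fun _ _ _ => norm_add_le _ _
    simpa [UNeg] using h
  zero_mem' := by
    have h : UNeg (univ : Set Unit) (fun _ _ => 0) := UNeg.zero
    simpa [UNeg] using h
  smul_mem' a b hb := by
    have h : UNeg (univ : Set Unit) (fun ε _ => ‖a.1 ε‖ * ‖b.1 ε‖) :=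
      UMod.mul_neg (uMod_of_mem a.2) (by simpa [UNeg] using hb) fun _ _ => norm_nonneg _
    simpa [UNeg] using h

/-- The ring of generalized complex constants. -/
abbrev GenConst : Type := moderateConst ⧸ negligibleConst

/-! ### The special algebra on an open set -/

section Algebra

variable {d : ℕ}

/-- Moderateness on `Ω`: each derivative is bounded, uniformly on each compact subset of `Ω`, by a
power of `1/ε`. -/
def IsModerate (Ω : Opens (Rd d)) (u : Idx → Rd d → ℂ) : Prop :=
  ∀ K : Set (Rd d), IsCompact K → K ⊆ Ω → ∀ n : ℕ, ∃ N : ℕ, ∀ᶠ ε in smallEps, ∀ x ∈ K,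
    ‖iteratedFDerivWithin ℝ n (u ε) Ω x‖ ≤ ((ε : ℝ)⁻¹) ^ N

/-- Negligibility on `Ω`: each derivative is bounded, uniformly on each compact subset of `Ω`, by
all powers of `ε`. -/
def IsNegligible (Ω : Opens (Rd d)) (u : Idx → Rd d → ℂ) : Prop :=
  ∀ K : Set (Rd d), IsCompact K → K ⊆ Ω → ∀ n : ℕ, ∀ m : ℕ, ∀ᶠ ε in smallEps, ∀ x ∈ K,
    ‖iteratedFDerivWithin ℝ n (u ε) Ω x‖ ≤ (ε : ℝ) ^ m

lemma uniqueDiff (Ω : Opens (Rd d)) : UniqueDiffOn ℝ (Ω : Set (Rd d)) := Ω.isOpen.uniqueDiffOn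

lemma IsModerate.congr {Ω : Opens (Rd d)} {u v : Idx → Rd d → ℂ} (hu : IsModerate Ω u)
    (h : ∀ ε, EqOn (v ε) (u ε) Ω) : IsModerate Ω v := fun K hK hKΩ n =>
  UMod.mono (hu K hK hKΩ n) fun ε _ hx =>
    (congrArg norm (iteratedFDerivWithin_congr (h ε) (hKΩ hx) n)).le

lemma IsNegligible.congr {Ω : Opens (Rd d)} {u v : Idx → Rd d → ℂ} (hu : IsNegligible Ω u)
    (h : ∀ ε, EqOn (v ε) (u ε) Ω) : IsNegligible Ω v := fun K hK hKΩ n =>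
  UNeg.mono (hu K hK hKΩ n) fun ε _ hx =>
    (congrArg norm (iteratedFDerivWithin_congr (h ε) (hKΩ hx) n)).le

lemma norm_iteratedFDerivWithin_add_le {Ω : Opens (Rd d)} {u v : Rd d → ℂ}
    (hu : ContDiffOn ℝ ∞ u Ω) (hv : ContDiffOn ℝ ∞ v Ω) (n : ℕ) {x : Rd d} (hx : x ∈ Ω) :
    ‖iteratedFDerivWithin ℝ n (u + v) Ω x‖ ≤
      ‖iteratedFDerivWithin ℝ n u Ω x‖ + ‖iteratedFDerivWithin ℝ n v Ω x‖ := by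
  rw [iteratedFDerivWithin_add_apply ((hu x hx).of_le (by exact_mod_cast le_top))
    ((hv x hx).of_le (by exact_mod_cast le_top)) (uniqueDiff Ω) hx]
  exact norm_add_le _ _

lemma isModerate_const_net {Ω : Opens (Rd d)} {a : Rd d → ℂ} (ha : ContDiffOn ℝ ∞ a Ω) :
    IsModerate Ω (fun _ => a) := by
  intro K hK hKΩ n
  obtain ⟨C, hC⟩ := hK.exists_bound_of_continuousOn
    ((ha.continuousOn_iteratedFDerivWithin (m := n) (by exact_mod_cast le_top)
      (uniqueDiff Ω)).mono hKΩ)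
  exact UMod.mono (UMod.const C) fun _ x hx => hC x hx

/-- The algebra of moderate nets of smooth functions on `Ω`. Functions are total; only their
restrictions to `Ω` matter. -/
def moderateNets (Ω : Opens (Rd d)) : Subalgebra ℂ (Idx → Rd d → ℂ) where
  carrier := {u | (∀ ε, ContDiffOn ℝ ∞ (u ε) Ω) ∧ IsModerate Ω u}
  mul_mem' {u v} hu hv := by
    refine ⟨fun ε => (hu.1 ε).mul (hv.1 ε), fun K hK hKΩ n => ?_⟩
    exact UMod.mono (UMod.sum (Finset.range (n + 1)) fun i _ => ((UMod.const (n.choose i : ℝ)).mul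
      (hu.2 K hK hKΩ i) fun _ _ => norm_nonneg _).mul (hv.2 K hK hKΩ (n - i))
        fun _ _ => norm_nonneg _) fun ε x hx =>
      norm_iteratedFDerivWithin_mul_le (hu.1 ε) (hv.1 ε) (uniqueDiff Ω) (hKΩ hx)
        (by exact_mod_cast le_top)
  add_mem' {u v} hu hv := by
    refine ⟨fun ε => (hu.1 ε).add (hv.1 ε), fun K hK hKΩ n => ?_⟩
    exact UMod.mono (UMod.add (hu.2 K hK hKΩ n) (hv.2 K hK hKΩ n)) fun ε x hx =>
      norm_iteratedFDerivWithin_add_le (hu.1 ε) (hv.1 ε) n (hKΩ hx)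
  algebraMap_mem' r :=
    ⟨fun _ => contDiffOn_const, isModerate_const_net (a := fun _ => r) contDiffOn_const⟩

/-- The ideal of negligible nets of smooth functions on `Ω`. -/
def negligibleNets (Ω : Opens (Rd d)) : Ideal (moderateNets Ω) where
  carrier := {u | IsNegligible Ω u.1}
  add_mem' {u v} hu hv := fun K hK hKΩ n =>
    UNeg.mono (UNeg.add (hu K hK hKΩ n) (hv K hK hKΩ n)) fun ε _ hx =>
      norm_iteratedFDerivWithin_add_le (u.2.1 ε) (v.2.1 ε) n (hKΩ hx)
  zero_mem' := by
    intro K hK hKΩ n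
    refine UNeg.mono UNeg.zero fun ε x hx => ?_
    have : ((0 : moderateNets Ω).1 ε) = fun _ => (0 : ℂ) := rfl
    rw [this]
    simp
  smul_mem' u v hv := by
    intro K hK hKΩ n
    exact UNeg.mono (UNeg.sum (Finset.range (n + 1)) fun i _ =>
      ((UMod.const (n.choose i : ℝ)).mul
      (u.2.2 K hK hKΩ i) fun _ _ => norm_nonneg _).mul_neg (hv K hK hKΩ (n - i))
        fun _ _ => norm_nonneg _) fun ε x hx =>
      norm_iteratedFDerivWithin_mul_le (u.2.1 ε) (v.2.1 ε) (uniqueDiff Ω) (hKΩ hx)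
        (by exact_mod_cast le_top)

/-- The special Colombeau algebra of generalized functions on `Ω`. -/
abbrev GenFun (Ω : Opens (Rd d)) : Type := moderateNets Ω ⧸ negligibleNets Ω

/-- A smooth function on `Ω`, seen as the generalized function with constant representative. -/
def ofSmooth {Ω : Opens (Rd d)} (a : Rd d → ℂ) (ha : ContDiffOn ℝ ∞ a Ω) : GenFun Ω :=
  Ideal.Quotient.mk (negligibleNets Ω) ⟨fun _ => a, fun _ => ha, isModerate_const_net ha⟩

/-! ### Composition with a smooth map -/

lemma exists_comp_bound {Ω Ω' : Opens (Rd d)} {ψ : Rd d → Rd d} (hψ : ContDiffOn ℝ ∞ ψ Ω')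
    (hm : MapsTo ψ Ω' Ω) {K : Set (Rd d)} (hK : IsCompact K) (hKΩ : K ⊆ Ω') (n : ℕ) :
    ∃ D : ℝ, 0 ≤ D ∧ ∀ u : Rd d → ℂ, ContDiffOn ℝ ∞ u Ω → ∀ x ∈ K,
      ‖iteratedFDerivWithin ℝ n (fun y => u (ψ y)) Ω' x‖ ≤
        D * ∑ i ∈ Finset.range (n + 1), ‖iteratedFDerivWithin ℝ i u Ω (ψ x)‖ := by
  have hb : ∀ i : ℕ, ∃ C : ℝ, ∀ x ∈ K, ‖iteratedFDerivWithin ℝ i ψ Ω' x‖ ≤ C := fun i =>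
    hK.exists_bound_of_continuousOn
      ((hψ.continuousOn_iteratedFDerivWithin (m := i) (by exact_mod_cast le_top)
        (uniqueDiff Ω')).mono hKΩ)
  choose C hC using hb
  set D : ℝ := 1 + ∑ i ∈ Finset.range (n + 1), |C i| with hD
  have hD1 : 1 ≤ D := by
    have : 0 ≤ ∑ i ∈ Finset.range (n + 1), |C i| := Finset.sum_nonneg fun _ _ => abs_nonneg _
    linarith
  refine ⟨n.factorial * D ^ n, by positivity, fun u hu x hx => ?_⟩
  have h := norm_iteratedFDerivWithin_comp_le (n := n) hu hψ (by exact_mod_cast le_top)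
    (uniqueDiff Ω) (uniqueDiff Ω') hm (hKΩ hx)
    (C := ∑ i ∈ Finset.range (n + 1), ‖iteratedFDerivWithin ℝ i u Ω (ψ x)‖) (D := D)
    (fun i hi => Finset.single_le_sum (f := fun i => ‖iteratedFDerivWithin ℝ i u Ω (ψ x)‖)
      (fun _ _ => norm_nonneg _) (Finset.mem_range.2 (by omega)))
    (fun i h1 hi => by
      have h2 : |C i| ≤ ∑ i ∈ Finset.range (n + 1), |C i| :=
        Finset.single_le_sum (f := fun i => |C i|)
          (fun _ _ => abs_nonneg _) (Finset.mem_range.2 (by omega))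
      calc _ ≤ C i := hC i x hx
        _ ≤ |C i| := le_abs_self _
        _ ≤ D := by linarith
        _ ≤ D ^ i := le_self_pow₀ hD1 (by omega))
  refine h.trans (le_of_eq ?_)
  ring

lemma UMod.comp {X Y : Type*} {K : Set X} {F : Idx → Y → ℝ} {ψ : X → Y} (h : UMod (ψ '' K) F) :
    UMod K (fun ε x => F ε (ψ x)) := by
  simpa [UMod] using h

lemma UNeg.comp {X Y : Type*} {K : Set X} {F : Idx → Y → ℝ} {ψ : X → Y} (h : UNeg (ψ '' K) F) :
    UNeg K (fun ε x => F ε (ψ x)) := by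
  simpa [UNeg] using h

/-- Composition with a smooth map, on moderate nets. -/
def pullbackNet {Ω Ω' : Opens (Rd d)} (ψ : Rd d → Rd d) (hψ : ContDiffOn ℝ ∞ ψ Ω')
    (hm : MapsTo ψ Ω' Ω) : moderateNets Ω →+* moderateNets Ω' where
  toFun u := ⟨fun ε x => u.1 ε (ψ x), fun ε => (u.2.1 ε).comp hψ hm, by
    intro K hK hKΩ n
    obtain ⟨D, hD, h⟩ := exists_comp_bound hψ hm hK hKΩ n
    have hK' : IsCompact (ψ '' K) := hK.image_of_continuousOn (hψ.continuousOn.mono hKΩ)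
    have hKΩ' : ψ '' K ⊆ Ω := (hm.mono_left hKΩ).image_subset
    exact UMod.mono ((UMod.const D).mul (UMod.sum (Finset.range (n + 1)) fun i _ =>
      UMod.comp (u.2.2 _ hK' hKΩ' i)) fun _ _ => Finset.sum_nonneg fun _ _ => norm_nonneg _)
      fun ε x hx => h (u.1 ε) (u.2.1 ε) x hx⟩
  map_one' := rfl
  map_mul' _ _ := rfl
  map_zero' := rfl
  map_add' _ _ := rfl

/-- The generalized function `x ↦ f (ψ x)`, for `ψ : Ω' → Ω` smooth. -/
def pullback {Ω Ω' : Opens (Rd d)} (ψ : Rd d → Rd d) (hψ : ContDiffOn ℝ ∞ ψ Ω')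
    (hm : MapsTo ψ Ω' Ω) : GenFun Ω →+* GenFun Ω' :=
  Ideal.quotientMap (negligibleNets Ω') (pullbackNet ψ hψ hm) (by
    intro u hu K hK hKΩ n
    obtain ⟨D, hD, h⟩ := exists_comp_bound hψ hm hK hKΩ n
    have hK' : IsCompact (ψ '' K) := hK.image_of_continuousOn (hψ.continuousOn.mono hKΩ)
    have hKΩ' : ψ '' K ⊆ Ω := (hm.mono_left hKΩ).image_subset
    exact UNeg.mono ((UMod.const D).mul_neg (UNeg.sum (Finset.range (n + 1)) fun i _ =>
      UNeg.comp (hu _ hK' hKΩ' i)) fun _ _ => Finset.sum_nonneg fun _ _ => norm_nonneg _)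
      fun ε x hx => h (u.1 ε) (u.2.1 ε) x hx)

/-! ### The action on test functions -/

lemma integrable_mul_testFunction {Ω : Opens (Rd d)} {u : Rd d → ℂ} (hu : ContDiffOn ℝ ∞ u Ω)
    (φ : 𝓓(Ω, ℂ)) : Integrable (fun x => u x * φ x) := by
  have hsupp : tsupport (fun x => u x * φ x) ⊆ tsupport φ :=
    closure_mono fun x hx => by
      intro h
      exact hx (by simp [h])
  have hc : Continuous (fun x => u x * φ x) := by
    rw [continuous_iff_continuousAt]
    intro x
    by_cases hx : x ∈ Ω
    · exact ((hu.continuousOn x hx).continuousAt (Ω.isOpen.mem_nhds hx)).mul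
        φ.continuous.continuousAt
    · have h : (tsupport φ)ᶜ ∈ 𝓝 x :=
        (isClosed_tsupport _).isOpen_compl.mem_nhds fun h => hx (φ.tsupport_subset h)
      refine continuousAt_const (y := (0 : ℂ)) |>.congr ?_
      filter_upwards [h] with y hy
      simp [image_eq_zero_of_notMem_tsupport hy]
  exact hc.integrable_of_hasCompactSupport (φ.hasCompactSupport.of_isClosed_subset
    (isClosed_tsupport _) hsupp)

lemma norm_integral_mul_testFunction_le {Ω : Opens (Rd d)} {u : Rd d → ℂ} (φ : 𝓓(Ω, ℂ)) {C : ℝ}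
    (hC : ∀ x ∈ tsupport φ, ‖iteratedFDerivWithin ℝ 0 u Ω x‖ ≤ C) :
    ‖∫ x, u x * φ x‖ ≤ C * ∫ x, ‖φ x‖ := by
  rw [← integral_const_mul]
  refine norm_integral_le_of_norm_le
    ((φ.continuous.integrable_of_hasCompactSupport φ.hasCompactSupport).norm.const_mul C)
    (Eventually.of_forall fun x => ?_)
  rw [norm_mul]
  by_cases hx : x ∈ tsupport φ
  · have := hC x hx
    rw [norm_iteratedFDerivWithin_zero] at this
    gcongr
  · simp [image_eq_zero_of_notMem_tsupport hx]

/-- The net `ε ↦ ∫ u_ε φ`. -/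
def pairNet {Ω : Opens (Rd d)} (u : moderateNets Ω) (φ : 𝓓(Ω, ℂ)) : moderateConst :=
  ⟨fun ε => ∫ x, u.1 ε x * φ x, by
    obtain ⟨N, hN⟩ := u.2.2 (tsupport φ) φ.hasCompactSupport φ.tsupport_subset 0
    have h : UMod (univ : Set Unit) (fun ε _ => ‖∫ x, u.1 ε x * φ x‖) := by
      refine UMod.of_const_mul (∫ x, ‖φ x‖) N (hN.mono fun ε h _ _ => ?_)
      rw [mul_comm]
      exact norm_integral_mul_testFunction_le φ h
    exact mem_of_uMod h⟩

/-- The generalized constant `∫ f φ`, for `f ∈ 𝒢(Ω)` and `φ ∈ 𝒟(Ω)`. -/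
def pairing {Ω : Opens (Rd d)} (f : GenFun Ω) (φ : 𝓓(Ω, ℂ)) : GenConst :=
  Quotient.liftOn' f (fun u => Ideal.Quotient.mk negligibleConst (pairNet u φ)) (by
    intro u v huv
    have huv' : IsNegligible Ω (u - v).1 := (Submodule.quotientRel_def _).1 huv
    refine Ideal.Quotient.eq.2 ?_
    have h : UNeg (univ : Set Unit) (fun ε _ => ‖∫ x, (u - v).1 ε x * φ x‖) := by
      refine UNeg.of_const_mul fun m => ⟨∫ x, ‖φ x‖, ?_⟩
      refine (huv' (tsupport φ) φ.hasCompactSupport φ.tsupport_subset 0 m).mono fun ε h _ _ => ?_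
      rw [mul_comm]
      exact norm_integral_mul_testFunction_le φ h
    have h2 : ∀ ε, (pairNet u φ - pairNet v φ).1 ε = ∫ x, (u - v).1 ε x * φ x := by
      intro ε
      change (∫ x, u.1 ε x * φ x) - (∫ x, v.1 ε x * φ x) = ∫ x, (u.1 ε x - v.1 ε x) * φ x
      rw [← integral_sub (integrable_mul_testFunction (u.2.1 ε) φ)
        (integrable_mul_testFunction (v.2.1 ε) φ)]
      simp only [sub_mul]
    change ∀ m : ℕ, ∀ᶠ ε in smallEps, ‖(pairNet u φ - pairNet v φ).1 ε‖ ≤ (ε : ℝ) ^ m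
    simpa [UNeg, h2] using h)

/-- Equality in the sense of generalized distributions. -/
def EqGenDist {Ω : Opens (Rd d)} (f g : GenFun Ω) : Prop :=
  ∀ φ : 𝓓(Ω, ℂ), pairing f φ = pairing g φ

end Algebra

/-! ### Homogeneity on the punctured space -/

section Homogeneity

variable {d : ℕ}

/-- `ℝ^d ∖ {0}`. -/
def punctured (d : ℕ) : Opens (Rd d) := ⟨{0}ᶜ, isOpen_compl_singleton⟩

/-- The open half-line `ℝ⁺`. -/
def posReals : Opens ℝ := ⟨Ioi 0, isOpen_Ioi⟩

lemma mem_punctured {x : Rd d} : x ∈ punctured d ↔ x ≠ 0 := Iff.rfl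

lemma mapsTo_smul_punctured {c : ℝ} (hc : 0 < c) :
    MapsTo (fun x : Rd d => c • x) (punctured d) (punctured d) := fun _ hx =>
  smul_ne_zero hc.ne' (mem_punctured.1 hx)

/-- The generalized function `x ↦ f (c x)`, for `c > 0`. -/
def dilate (c : ℝ) (hc : 0 < c) (f : GenFun (punctured d)) : GenFun (punctured d) :=
  pullback (fun x => c • x) (by fun_prop) (mapsTo_smul_punctured hc) f

/-- `f (c x) = c ^ α f (x)` in the algebra, for each real `c > 0`. -/
def IsStronglyHomogeneous (α : ℝ) (f : GenFun (punctured d)) : Prop :=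
  ∀ (c : ℝ) (hc : 0 < c), dilate c hc f = ((c ^ α : ℝ) : ℂ) • f

/-- `∫ f (c x) φ(x) dx = ∫ c ^ α f (x) φ(x) dx` for each real `c > 0` and each test function `φ`. -/
def IsWeaklyHomogeneous (α : ℝ) (f : GenFun (punctured d)) : Prop :=
  ∀ (c : ℝ) (hc : 0 < c), EqGenDist (dilate c hc f) (((c ^ α : ℝ) : ℂ) • f)

lemma contDiffOn_norm_punctured : ContDiffOn ℝ ∞ (fun x : Rd d => ‖x‖) (punctured d) :=
  fun _ hx => (contDiffAt_norm ℝ (mem_punctured.1 hx)).contDiffWithinAt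

/-- The generalized function `x ↦ |x| ^ α` on `ℝ^d ∖ {0}`. -/
def normPow (d : ℕ) (α : ℝ) : GenFun (punctured d) :=
  ofSmooth (fun x => ((‖x‖ ^ α : ℝ) : ℂ))
    (Complex.ofRealCLM.contDiff.comp_contDiffOn
      (contDiffOn_norm_punctured.rpow_const_of_ne fun _ hx =>
        norm_ne_zero_iff.2 (mem_punctured.1 hx)))

/-- The generalized function `x ↦ g (x / |x|)` on `ℝ^d ∖ {0}`. -/
def angular (g : GenFun (punctured d)) : GenFun (punctured d) :=
  pullback (fun x => ‖x‖⁻¹ • x)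
    ((contDiffOn_norm_punctured.inv fun _ hx => norm_ne_zero_iff.2 (mem_punctured.1 hx)).smul
      contDiffOn_id)
    (fun _ hx => smul_ne_zero (inv_ne_zero (norm_ne_zero_iff.2 (mem_punctured.1 hx)))
      (mem_punctured.1 hx)) g

/-! ### Radial means -/

section Parametric

variable {F : Type} [NormedAddCommGroup F] [NormedSpace ℝ F]

/-- The derivative in the first variable. -/
def partialFDeriv (H : Rd d → ℝ → F) (x : Rd d) (r : ℝ) : Rd d →L[ℝ] F :=
  (fderiv ℝ (Function.uncurry H) (x, r)).comp (ContinuousLinearMap.inl ℝ (Rd d) ℝ)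

lemma isOpen_strip (Ω : Opens (Rd d)) : IsOpen ((Ω : Set (Rd d)) ×ˢ Ioi (0 : ℝ)) :=
  Ω.isOpen.prod isOpen_Ioi

lemma contDiffOn_partialFDeriv {Ω : Opens (Rd d)} {H : Rd d → ℝ → F}
    (hH : ContDiffOn ℝ ∞ (Function.uncurry H) ((Ω : Set (Rd d)) ×ˢ Ioi 0)) :
    ContDiffOn ℝ ∞ (Function.uncurry (partialFDeriv H)) ((Ω : Set (Rd d)) ×ˢ Ioi 0) :=
  ((contDiffOn_infty_iff_fderiv_of_isOpen (isOpen_strip Ω)).1 hH).2.clm_comp contDiffOn_const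

lemma hasFDerivAt_slice {Ω : Opens (Rd d)} {H : Rd d → ℝ → F}
    (hH : ContDiffOn ℝ ∞ (Function.uncurry H) ((Ω : Set (Rd d)) ×ˢ Ioi 0))
    {x : Rd d} (hx : x ∈ Ω) {r : ℝ} (hr : 0 < r) :
    HasFDerivAt (fun y => H y r) (partialFDeriv H x r) x := by
  have h1 : HasFDerivAt (Function.uncurry H) (fderiv ℝ (Function.uncurry H) (x, r)) (x, r) :=
    ((hH.contDiffAt ((isOpen_strip Ω).mem_nhds (mk_mem_prod hx hr))).differentiableAt (by simp)).hasFDerivAt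
  have h2 : HasFDerivAt (fun y : Rd d => (y, r)) (ContinuousLinearMap.inl ℝ (Rd d) ℝ) x :=
    hasFDerivAt_prodMk_left x r
  exact HasFDerivAt.comp (g := Function.uncurry H) (f := fun y : Rd d => (y, r)) x h1 h2

lemma continuousOn_slice {Ω : Opens (Rd d)} {H : Rd d → ℝ → F}
    (hH : ContDiffOn ℝ ∞ (Function.uncurry H) ((Ω : Set (Rd d)) ×ˢ Ioi 0))
    {x : Rd d} (hx : x ∈ Ω) : ContinuousOn (H x) (Ioi 0) :=
  hH.continuousOn.comp (f := fun r : ℝ => (x, r)) (by fun_prop) fun _ hr => ⟨hx, hr⟩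

lemma hasFDerivAt_parametric {Ω : Opens (Rd d)} {H : Rd d → ℝ → F}
    (hH : ContDiffOn ℝ ∞ (Function.uncurry H) ((Ω : Set (Rd d)) ×ˢ Ioi 0))
    {a b : ℝ} (ha : 0 < a) (hab : a ≤ b) {x : Rd d} (hx : x ∈ Ω) :
    HasFDerivAt (fun y => ∫ r in a..b, H y r) (∫ r in a..b, partialFDeriv H x r) x := by
  obtain ⟨δ, hδ, hball⟩ := Metric.nhds_basis_closedBall.mem_iff.1 (Ω.isOpen.mem_nhds hx)
  have hsub : Icc a b ⊆ Ioi 0 := fun r hr => ha.trans_le hr.1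
  have huIcc : uIcc a b ⊆ Ioi 0 := by rwa [uIcc_of_le hab]
  have huIoc : uIoc a b ⊆ Icc a b := by rw [uIoc_of_le hab]; exact Ioc_subset_Icc_self
  have hcpt := (isCompact_closedBall x δ).prod (isCompact_Icc (a := a) (b := b))
  obtain ⟨C, hC⟩ := hcpt.exists_bound_of_continuousOn
    ((contDiffOn_partialFDeriv hH).continuousOn.mono (prod_mono hball hsub))
  refine intervalIntegral.hasFDerivAt_integral_of_dominated_of_fderiv_le
    (F' := partialFDeriv H) (bound := fun _ => C) (Metric.closedBall_mem_nhds x hδ) ?_ ?_ ?_ ?_ ?_ ?_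
  · filter_upwards [Ω.isOpen.mem_nhds hx] with y hy
    exact ((continuousOn_slice hH hy).mono (huIoc.trans hsub)).aestronglyMeasurable
      measurableSet_uIoc
  · exact ((continuousOn_slice hH hx).mono huIcc).intervalIntegrable
  · exact ((continuousOn_slice (contDiffOn_partialFDeriv hH) hx).mono
      (huIoc.trans hsub)).aestronglyMeasurable measurableSet_uIoc
  · exact Eventually.of_forall fun r hr y hy => hC (y, r) ⟨hy, huIoc hr⟩
  · exact intervalIntegrable_const
  · exact Eventually.of_forall fun r hr y hy => hasFDerivAt_slice hH (hball hy) (hsub (huIoc hr))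

end Parametric

lemma contDiffOn_nat_parametric (n : ℕ) {Ω : Opens (Rd d)} {a b : ℝ} (ha : 0 < a) (hab : a ≤ b) :
    ∀ {F : Type} [NormedAddCommGroup F] [NormedSpace ℝ F] {H : Rd d → ℝ → F},
    ContDiffOn ℝ ∞ (Function.uncurry H) ((Ω : Set (Rd d)) ×ˢ Ioi 0) →
    ContDiffOn ℝ n (fun y => ∫ r in a..b, H y r) Ω := by
  induction n with
  | zero =>
    intro F _ _ H hH
    exact contDiffOn_zero.2 fun x hx =>
      (hasFDerivAt_parametric hH ha hab hx).continuousAt.continuousWithinAt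
  | succ n ih =>
    intro F _ _ H hH
    push_cast
    rw [contDiffOn_succ_iff_fderiv_of_isOpen Ω.isOpen]
    refine ⟨fun x hx => (hasFDerivAt_parametric hH ha hab
      hx).differentiableAt.differentiableWithinAt, by simp, ?_⟩
    exact (ih (contDiffOn_partialFDeriv hH)).congr fun x hx =>
      (hasFDerivAt_parametric hH ha hab hx).fderiv

lemma norm_iteratedFDerivWithin_parametric_le (n : ℕ) {Ω : Opens (Rd d)} {a b : ℝ} (ha : 0 < a)
    (hab : a ≤ b) :
    ∀ {F : Type} [NormedAddCommGroup F] [NormedSpace ℝ F] {H : Rd d → ℝ → F},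
    ContDiffOn ℝ ∞ (Function.uncurry H) ((Ω : Set (Rd d)) ×ˢ Ioi 0) →
    ∀ {x : Rd d}, x ∈ Ω → ∀ {C : ℝ},
    (∀ r ∈ Icc a b, ‖iteratedFDerivWithin ℝ n (fun y => H y r) Ω x‖ ≤ C) →
    ‖iteratedFDerivWithin ℝ n (fun y => ∫ r in a..b, H y r) Ω x‖ ≤ C * (b - a) := by
  induction n with
  | zero =>
    intro F _ _ H hH x hx C hC
    simp only [norm_iteratedFDerivWithin_zero] at hC ⊢
    have := intervalIntegral.norm_integral_le_of_norm_le_const (a := a) (b := b) (f := H x) (C := C)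
      (fun r hr => hC r (by rw [uIoc_of_le hab] at hr; exact Ioc_subset_Icc_self hr))
    rwa [abs_of_nonneg (sub_nonneg.2 hab)] at this
  | succ n ih =>
    intro F _ _ H hH x hx C hC
    rw [← norm_iteratedFDerivWithin_fderivWithin (uniqueDiff Ω) hx]
    rw [iteratedFDerivWithin_congr (f := fun y => ∫ r in a..b, partialFDeriv H y r)
      (fun y hy => by
        rw [fderivWithin_of_isOpen Ω.isOpen hy]
        exact (hasFDerivAt_parametric hH ha hab hy).fderiv) hx]
    refine ih (contDiffOn_partialFDeriv hH) hx fun r hr => ?_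
    refine le_trans (le_of_eq ?_) (hC r hr)
    rw [← norm_iteratedFDerivWithin_fderivWithin (uniqueDiff Ω) hx]
    exact congrArg norm (iteratedFDerivWithin_congr (fun y hy =>
      ((fderivWithin_of_isOpen Ω.isOpen hy).trans
        (hasFDerivAt_slice hH hy (ha.trans_le hr.1)).fderiv).symm) hx n)

lemma exists_support_bounds (w : 𝓓(posReals, ℂ)) :
    ∃ a b : ℝ, 0 < a ∧ a ≤ b ∧ ∀ r, r ∉ Icc a b → w r = 0 := by
  rcases (tsupport w).eq_empty_or_nonempty with h | h
  · exact ⟨1, 1, one_pos, le_rfl, fun r _ =>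
      image_eq_zero_of_notMem_tsupport (by simp [h])⟩
  · obtain ⟨a, ha⟩ := w.hasCompactSupport.isCompact.exists_isLeast h
    obtain ⟨b, hb⟩ := w.hasCompactSupport.isCompact.exists_isGreatest h
    exact ⟨a, b, w.tsupport_subset ha.1, ha.2 hb.1, fun r hr =>
      image_eq_zero_of_notMem_tsupport fun h => hr ⟨ha.2 h, hb.2 h⟩⟩

/-- The function `x ↦ ∫_{ℝ⁺} v(r x) / r ^ α * w(r) dr`. -/
def radialIntegral (α : ℝ) (w : 𝓓(posReals, ℂ)) (v : Rd d → ℂ) (x : Rd d) : ℂ :=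
  ∫ r in Ioi (0 : ℝ), v (r • x) / ((r ^ α : ℝ) : ℂ) * w r

lemma radialIntegral_eq (α : ℝ) (w : 𝓓(posReals, ℂ)) {a b : ℝ} (ha : 0 < a) (hab : a ≤ b)
    (hw : ∀ r, r ∉ Icc a b → w r = 0) (v : Rd d → ℂ) (x : Rd d) :
    radialIntegral α w v x = ∫ r in a..b, v (r • x) / ((r ^ α : ℝ) : ℂ) * w r := by
  rw [intervalIntegral.integral_of_le hab, ← integral_Icc_eq_integral_Ioc]
  exact setIntegral_eq_of_subset_of_forall_sdiff_eq_zero measurableSet_Ioi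
    (fun r hr => ha.trans_le hr.1) fun r hr => by simp [hw r hr.2]

lemma contDiffOn_radial_integrand (α : ℝ) (w : 𝓓(posReals, ℂ)) {v : Rd d → ℂ}
    (hv : ContDiffOn ℝ ∞ v (punctured d)) :
    ContDiffOn ℝ ∞ (Function.uncurry fun (x : Rd d) (r : ℝ) => v (r • x) / ((r ^ α : ℝ) : ℂ) * w r)
      ((punctured d : Set (Rd d)) ×ˢ Ioi 0) := by
  have h1 : ContDiffOn ℝ ∞ (fun p : Rd d × ℝ => v (p.2 • p.1))
      ((punctured d : Set (Rd d)) ×ˢ Ioi 0) :=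
    hv.comp (contDiff_snd.smul contDiff_fst).contDiffOn fun p hp =>
      smul_ne_zero (ne_of_gt hp.2) (mem_punctured.1 hp.1)
  have h2 : ContDiffOn ℝ ∞ (fun p : Rd d × ℝ => ((p.2 ^ α : ℝ) : ℂ))
      ((punctured d : Set (Rd d)) ×ˢ Ioi 0) :=
    Complex.ofRealCLM.contDiff.comp_contDiffOn
      (contDiff_snd.contDiffOn.rpow_const_of_ne fun p hp => ne_of_gt hp.2)
  have h3 : ContDiffOn ℝ ∞ (fun p : Rd d × ℝ => w p.2)
      ((punctured d : Set (Rd d)) ×ˢ Ioi 0) := (w.contDiff.comp contDiff_snd).contDiffOn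
  have h2' : ∀ p ∈ (punctured d : Set (Rd d)) ×ˢ Ioi (0 : ℝ), ((p.2 ^ α : ℝ) : ℂ) ≠ 0 :=
    fun p hp => Complex.ofReal_ne_zero.2 (Real.rpow_pos_of_pos hp.2 α).ne'
  simp only [Function.uncurry_def, div_eq_mul_inv]
  exact (h1.mul (h2.inv h2')).mul h3

lemma exists_radial_bound (α : ℝ) (w : 𝓓(posReals, ℂ)) {K : Set (Rd d)} (hK : IsCompact K)
    (hKΩ : K ⊆ punctured d) (n : ℕ) :
    ∃ K' : Set (Rd d), IsCompact K' ∧ K' ⊆ punctured d ∧ ∃ D : ℝ, 0 ≤ D ∧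
      ∀ v : Rd d → ℂ, ContDiffOn ℝ ∞ v (punctured d) → ∀ C : ℝ,
        (∀ y ∈ K', ‖iteratedFDerivWithin ℝ n v (punctured d) y‖ ≤ C) → ∀ x ∈ K,
        ‖iteratedFDerivWithin ℝ n (radialIntegral α w v) (punctured d) x‖ ≤ D * C := by
  obtain ⟨a, b, ha, hab, hw⟩ := exists_support_bounds w
  have hb : 0 < b := ha.trans_le hab
  refine ⟨(fun p : ℝ × Rd d => p.1 • p.2) '' (Icc a b ×ˢ K),
    (isCompact_Icc.prod hK).image (by fun_prop), ?_, ?_⟩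
  · rintro _ ⟨p, hp, rfl⟩
    exact smul_ne_zero (ha.trans_le hp.1.1).ne' (mem_punctured.1 (hKΩ hp.2))
  have hcont : ContinuousOn (fun r : ℝ => (((r ^ α : ℝ) : ℂ))⁻¹ * w r) (Icc a b) := by
    refine ContinuousOn.mul (ContinuousOn.inv₀ ?_ ?_) w.continuous.continuousOn
    · exact Complex.continuous_ofReal.comp_continuousOn
        (continuousOn_id.rpow_const fun r hr => Or.inl (ha.trans_le hr.1).ne')
    · exact fun r hr => Complex.ofReal_ne_zero.2 (Real.rpow_pos_of_pos (ha.trans_le hr.1) α).ne'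
  obtain ⟨M, hM⟩ := isCompact_Icc.exists_bound_of_continuousOn hcont
  have hM0 : 0 ≤ M := (norm_nonneg _).trans (hM a ⟨le_rfl, hab⟩)
  refine ⟨M * b ^ n * (b - a), by have := sub_nonneg.2 hab; positivity, fun v hv C hC x hx => ?_⟩
  have hx' : x ∈ punctured d := hKΩ hx
  rw [show radialIntegral α w v = fun x => ∫ r in a..b, v (r • x) / ((r ^ α : ℝ) : ℂ) * w r from
    funext fun x => radialIntegral_eq α w ha hab hw v x]
  rw [show M * b ^ n * (b - a) * C = (M * (b ^ n * C)) * (b - a) by ring]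
  refine norm_iteratedFDerivWithin_parametric_le n ha hab (contDiffOn_radial_integrand α w hv) hx'
    fun r hr => ?_
  have hr0 : 0 < r := ha.trans_le hr.1
  have hpre : (fun x : Rd d => r • x) ⁻¹' (punctured d : Set (Rd d)) = punctured d := by
    ext y
    simp [punctured, hr0.ne']
  set L : Rd d →L[ℝ] Rd d := r • ContinuousLinearMap.id ℝ (Rd d) with hL
  have hLn : ‖L‖ ≤ b := by
    refine L.opNorm_le_bound hb.le fun y => ?_
    simp only [hL, smul_apply, ContinuousLinearMap.id_apply, norm_smul,
      Real.norm_eq_abs, abs_of_pos hr0]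
    exact mul_le_mul_of_nonneg_right hr.2 (norm_nonneg _)
  have hLpre : L ⁻¹' (punctured d : Set (Rd d)) = punctured d := hpre
  have h1 : iteratedFDerivWithin ℝ n (v ∘ L) (punctured d) x =
      (iteratedFDerivWithin ℝ n v (punctured d) (L x)).compContinuousLinearMap fun _ => L := by
    have := L.iteratedFDerivWithin_comp_right (f := v) (s := (punctured d : Set (Rd d))) (n := ∞)
      hv (uniqueDiff _) (x := x) (by rw [hLpre]; exact uniqueDiff _)
      (mapsTo_smul_punctured hr0 hx') (i := n) (by exact_mod_cast le_top)
    rwa [hLpre] at this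
  have hLx : ‖iteratedFDerivWithin ℝ n v (punctured d) (L x)‖ ≤ C :=
    hC _ ⟨(r, x), ⟨hr, hx⟩, rfl⟩
  have h2 : ‖iteratedFDerivWithin ℝ n (v ∘ L) (punctured d) x‖ ≤ b ^ n * C := by
    rw [h1]
    refine (ContinuousMultilinearMap.norm_compContinuousLinearMap_le _ _).trans ?_
    rw [Finset.prod_const, Finset.card_univ, Fintype.card_fin, mul_comm]
    gcongr
  have h3 : (fun y : Rd d => v (r • y) / ((r ^ α : ℝ) : ℂ) * w r) =
      (((r ^ α : ℝ) : ℂ)⁻¹ * w r) • (v ∘ L) := by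
    funext y
    simp only [Pi.smul_apply, Function.comp, smul_eq_mul, hL, smul_apply,
      ContinuousLinearMap.id_apply]
    ring
  have h4 : ContDiffOn ℝ ∞ (v ∘ L) (punctured d) :=
    hv.comp L.contDiff.contDiffOn (mapsTo_smul_punctured hr0)
  rw [h3, iteratedFDerivWithin_const_smul_apply ((h4 x hx').of_le (by exact_mod_cast le_top))
    (uniqueDiff _) hx', norm_smul]
  exact mul_le_mul (hM r hr) h2 (norm_nonneg _) hM0

lemma contDiffOn_radialIntegral (α : ℝ) (w : 𝓓(posReals, ℂ)) {v : Rd d → ℂ}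
    (hv : ContDiffOn ℝ ∞ v (punctured d)) :
    ContDiffOn ℝ ∞ (radialIntegral α w v) (punctured d) := by
  obtain ⟨a, b, ha, hab, hw⟩ := exists_support_bounds w
  rw [show radialIntegral α w v = fun x => ∫ r in a..b, v (r • x) / ((r ^ α : ℝ) : ℂ) * w r from
    funext fun x => radialIntegral_eq α w ha hab hw v x]
  exact contDiffOn_infty.2 fun n =>
    contDiffOn_nat_parametric n ha hab (contDiffOn_radial_integrand α w hv)

/-- The net `ε ↦ (x ↦ ∫_{ℝ⁺} u_ε(r x) / r ^ α * w(r) dr)`. -/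
def radialMeanNet (α : ℝ) (w : 𝓓(posReals, ℂ)) (u : moderateNets (punctured d)) :
    moderateNets (punctured d) :=
  ⟨fun ε => radialIntegral α w (u.1 ε), fun ε => contDiffOn_radialIntegral α w (u.2.1 ε), by
    intro K hK hKΩ n
    obtain ⟨K', hK', hKΩ', D, -, h⟩ := exists_radial_bound α w hK hKΩ n
    obtain ⟨N, hN⟩ := u.2.2 K' hK' hKΩ' n
    exact UMod.of_const_mul D N (hN.mono fun ε hε => h (u.1 ε) (u.2.1 ε) _ hε)⟩

lemma radialIntegral_sub (α : ℝ) (w : 𝓓(posReals, ℂ)) {u v : Rd d → ℂ}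
    (hu : ContDiffOn ℝ ∞ u (punctured d)) (hv : ContDiffOn ℝ ∞ v (punctured d)) {x : Rd d}
    (hx : x ∈ punctured d) :
    radialIntegral α w u x - radialIntegral α w v x = radialIntegral α w (u - v) x := by
  obtain ⟨a, b, ha, hab, hw⟩ := exists_support_bounds w
  have hsub : uIcc a b ⊆ Ioi 0 := by
    rw [uIcc_of_le hab]
    exact fun r hr => ha.trans_le hr.1
  simp only [radialIntegral_eq α w ha hab hw]
  rw [← intervalIntegral.integral_sub]
  · refine intervalIntegral.integral_congr fun r _ => ?_
    simp only [Pi.sub_apply]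
    ring
  · exact ((continuousOn_slice (contDiffOn_radial_integrand α w hu) hx).mono
      hsub).intervalIntegrable
  · exact ((continuousOn_slice (contDiffOn_radial_integrand α w hv) hx).mono
      hsub).intervalIntegrable

/-- The radial mean `x ↦ ∫_{ℝ⁺} f(r x) / r ^ α * w(r) dr`, as a generalized function on
`ℝ^d ∖ {0}`. -/
def radialMean (α : ℝ) (w : 𝓓(posReals, ℂ)) (f : GenFun (punctured d)) : GenFun (punctured d) :=
  Quotient.liftOn' f (fun u => Ideal.Quotient.mk (negligibleNets _) (radialMeanNet α w u)) (by
    intro u v huv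
    have huv' : IsNegligible (punctured d) (u - v).1 := (Submodule.quotientRel_def _).1 huv
    refine Ideal.Quotient.eq.2 ?_
    have h : IsNegligible (punctured d) fun ε => radialIntegral α w ((u - v).1 ε) := by
      intro K hK hKΩ n
      obtain ⟨K', hK', hKΩ', D, -, h⟩ := exists_radial_bound α w hK hKΩ n
      exact UNeg.of_const_mul fun m => ⟨D, (huv' K' hK' hKΩ' n m).mono fun ε hε =>
        h ((u - v).1 ε) ((u - v).2.1 ε) _ hε⟩
    exact h.congr fun ε x hx => radialIntegral_sub α w (u.2.1 ε) (v.2.1 ε) hx)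

end Homogeneity

end Colombeau

end

/-!
The difficulty is that weak homogeneity is a separate statement for each dilation and each test
function: how small `ε` must be depends on both, and on the order `m` of the estimate. Averaging
over dilations needs an estimate uniform in the dilation, which pointwise estimates for one test
function do not give. The uniformity comes from the completeness of spaces of test functions.

Fix `m` and a sequence `ε n → 0`, which suffices by `negligible_of_forall_seq`, and put
`U n = (ε n) ^ (-m) u_{ε n}` for a representative `u` of `f`. Weak homogeneity says that
`∫ (U n (c x) - c ^ α U n x) φ x dx` is bounded in `n` for each `c` and `φ`. Uniformity is
obtained in two steps, combined in `exists_bound_dilation`.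

* For a fixed dilation, the bound is uniform over a smooth family of test functions with compact
  parameter set and common compact support (`exists_bound_of_smooth_family`). Otherwise some
  sequence of members of the family would be bad; sums of these members with coefficients in `ℓ¹`
  are test functions again, and Banach–Steinhaus on `ℓ¹` gives a contradiction.
* Writing `c = exp t`, the function `H t = exp (-α t) ∫ U n (exp t x) Θ x dx` then has increments
  `H (s + t) - H s` bounded locally uniformly in `s`, for each `t`, since rescaling the test
  function moves `s` into the family. The Baire category theorem makes this uniform in `t`
  (`exists_bound_of_increments`).

By the substitution `r = ρ |x|` and Fubini, the difference between the two sides of the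
representation formula is the integral, over `ρ` in a compact interval of `(0, ∞)`, of the defect
`∫ (u (ρ x) / ρ ^ α - u x) φ x |x| u₀ (ρ |x|) dx` (`exists_radial_defect`). The test function
depends on `ρ`, which is why uniformity over families of test functions is needed as well.

The polar form `x ↦ g (x / |x|) |x| ^ α` has homogeneous representatives, whence strong
homogeneity.
-/

noncomputable section

namespace Colombeau

/-! ### Negligible constants along sequences -/

lemma exists_bound_seq_of_negligible {c : Idx → ℂ} {m : ℕ}
    (hc : ∀ᶠ ε in smallEps, ‖c ε‖ ≤ (ε : ℝ) ^ m) {e : ℕ → Idx} (he : Tendsto e atTop smallEps) :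
    ∃ C : ℝ, ∀ n, ‖((((e n : ℝ)⁻¹) ^ m : ℝ) : ℂ) * c (e n)‖ ≤ C := by
  have h : IsBoundedUnder (· ≤ ·) atTop fun n => ‖((((e n : ℝ)⁻¹) ^ m : ℝ) : ℂ) * c (e n)‖ := by
    refine ⟨1, eventually_map.2 ?_⟩
    filter_upwards [he.eventually hc] with n hn
    have h0 : (0 : ℝ) < e n := (e n).2.1
    rw [norm_mul, Complex.norm_real, Real.norm_eq_abs, abs_of_pos (by positivity)]
    calc ((e n : ℝ)⁻¹) ^ m * ‖c (e n)‖ ≤ ((e n : ℝ)⁻¹) ^ m * (e n : ℝ) ^ m := by gcongr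
      _ = 1 := by rw [← mul_pow, inv_mul_cancel₀ h0.ne', one_pow]
  obtain ⟨C, hC⟩ := h.bddAbove_range
  exact ⟨C, fun n => hC ⟨n, rfl⟩⟩

/-- Negligibility of a net of constants can be tested along sequences of parameters tending
to `0`; this makes the countable Baire arguments below applicable to nets. -/
lemma negligible_of_forall_seq {c : Idx → ℂ}
    (h : ∀ (m : ℕ) (e : ℕ → Idx), Tendsto e atTop smallEps →
      ∃ C : ℝ, ∀ n, ‖((((e n : ℝ)⁻¹) ^ m : ℝ) : ℂ) * c (e n)‖ ≤ C) (m : ℕ) :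
    ∀ᶠ ε in smallEps, ‖c ε‖ ≤ (ε : ℝ) ^ m := by
  have : smallEps.IsCountablyGenerated := by unfold smallEps; infer_instance
  by_contra hcon
  obtain ⟨e, he, hlt⟩ := exists_seq_forall_of_frequently (not_eventually.1 hcon)
  obtain ⟨C, hC⟩ := h (m + 1) e he
  have hpos : (0 : ℝ) < (max C 1 + 1)⁻¹ := by positivity
  obtain ⟨n, hn⟩ := (he.eventually (eventually_le_smallEps hpos)).exists
  have h0 : (0 : ℝ) < e n := (e n).2.1
  have h1 := hC n
  rw [norm_mul, Complex.norm_real, Real.norm_eq_abs, abs_of_pos (by positivity)] at h1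
  have h2 : max C 1 + 1 ≤ (e n : ℝ)⁻¹ := (le_inv_comm₀ h0 (by positivity)).1 hn
  have h3 : (e n : ℝ)⁻¹ ≤ ((e n : ℝ)⁻¹) ^ (m + 1) * ‖c (e n)‖ := by
    calc (e n : ℝ)⁻¹ = ((e n : ℝ)⁻¹) ^ (m + 1) * (e n : ℝ) ^ m := by
          rw [pow_succ, mul_right_comm, ← mul_pow, inv_mul_cancel₀ h0.ne', one_pow, one_mul]
      _ ≤ _ := by gcongr; exact (not_le.1 (hlt n)).le
  linarith [le_max_left C 1]

/-! ### Uniform bounds for increments -/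

/-- If the increments `s ↦ H (s + t) - H s` of a family of continuous functions are bounded on
compact intervals for each `t` separately, then they are bounded uniformly for `t` in compact
intervals. This is the Baire category theorem, applied to the closed sets of those `t` whose
increments `H x - H (x - t)` are bounded by `j` for `|x| ≤ R`. -/
lemma exists_bound_of_increments {ι P : Type*} {H : ι → P → ℝ → ℂ} {S : Set P}
    (hH : ∀ i, ∀ p ∈ S, Continuous (H i p))
    (h : ∀ R t : ℝ, ∃ C : ℝ, ∀ i, ∀ p ∈ S, ∀ s, |s| ≤ R → ‖H i p (s + t) - H i p s‖ ≤ C) (R : ℝ) :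
    ∃ C : ℝ, ∀ i, ∀ p ∈ S, ∀ t, |t| ≤ R → ‖H i p t - H i p 0‖ ≤ C := by
  set A : ℕ → Set ℝ := fun j =>
    {t | ∀ i, ∀ p ∈ S, ∀ x, |x| ≤ R → ‖H i p x - H i p (x - t)‖ ≤ j} with hA
  have hclosed : ∀ j, IsClosed (A j) := fun j => by
    simp only [hA, Set.ofPred_forall]
    refine isClosed_iInter fun i => isClosed_iInter fun p => isClosed_iInter fun hp =>
      isClosed_iInter fun x => isClosed_iInter fun _ => ?_
    have := hH i p hp
    exact isClosed_le (by fun_prop) continuous_const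
  have hunion : ⋃ j, A j = univ := by
    refine eq_univ_of_forall fun t => mem_iUnion.2 ?_
    obtain ⟨C, hC⟩ := h (R + |t|) t
    obtain ⟨j, hj⟩ := exists_nat_ge C
    refine ⟨j, fun i p hp x hx => ?_⟩
    have := hC i p hp (x - t) ((abs_sub _ _).trans (by linarith))
    rw [sub_add_cancel] at this
    exact this.trans hj
  obtain ⟨j, t₀, ht₀⟩ := nonempty_interior_of_iUnion_of_closed hclosed hunion
  obtain ⟨δ, hδ, hball⟩ := Metric.nhds_basis_closedBall.mem_iff.1 (mem_interior_iff_mem_nhds.1 ht₀)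
  obtain ⟨C, hC⟩ := h (R + δ + |t₀|) t₀
  -- Increments with a short step `τ`: pass from `x` to `x - (t₀ + τ)` and back by `t₀`.
  have hstep : ∀ i, ∀ p ∈ S, ∀ x τ, |x| ≤ R → |τ| ≤ δ → ‖H i p x - H i p (x - τ)‖ ≤ j + C := by
    intro i p hp x τ hx hτ
    have h1 : ‖H i p x - H i p (x - (t₀ + τ))‖ ≤ j :=
      hball (by simpa [Real.dist_eq] using hτ) i p hp x hx
    have h2 := hC i p hp (x - (t₀ + τ)) (by
      rw [abs_le] at *; constructor <;> cases abs_cases t₀ <;> linarith)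
    rw [show x - (t₀ + τ) + t₀ = x - τ by ring] at h2
    rw [show H i p x - H i p (x - τ) = (H i p x - H i p (x - (t₀ + τ))) -
      (H i p (x - τ) - H i p (x - (t₀ + τ))) by ring]
    exact (norm_sub_le _ _).trans (add_le_add h1 h2)
  have hchain : ∀ k : ℕ, ∀ i, ∀ p ∈ S, ∀ t, |t| ≤ R → |t| ≤ k * δ →
      ‖H i p t - H i p 0‖ ≤ k * (j + C) := by
    intro k i p hp
    induction k with
    | zero =>
      intro t _ ht
      have : t = 0 := abs_nonpos_iff.1 (by simpa using ht)
      simp [this]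
    | succ k ih =>
      intro t htR ht
      push_cast at ht ⊢
      have hk : (0 : ℝ) < k + 1 := by positivity
      set τ : ℝ := t / (k + 1) with hτ
      have ht' : t = (k + 1) * τ := by rw [hτ]; field_simp
      have hτa : |t| = (k + 1) * |τ| := by rw [ht', abs_mul, abs_of_pos hk]
      have hτδ : |τ| ≤ δ := by rw [hτa] at ht; exact le_of_mul_le_mul_left ht hk
      have hsub : |t - τ| = k * |τ| := by
        rw [show t - τ = k * τ by rw [ht']; ring, abs_mul, Nat.abs_cast]
      have h1 := ih (t - τ) (by rw [hsub]; nlinarith [abs_nonneg τ]) (by rw [hsub]; gcongr)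
      have h2 := hstep i p hp t τ htR hτδ
      rw [show H i p t - H i p 0 = (H i p t - H i p (t - τ)) + (H i p (t - τ) - H i p 0) by ring]
      refine (norm_add_le _ _).trans ?_
      linarith
  obtain ⟨k, hk⟩ := exists_nat_ge (R / δ)
  exact ⟨k * (j + C), fun i p hp t ht => hchain k i p hp t ht
    (ht.trans ((div_le_iff₀ hδ).1 hk))⟩

/-! ### Uniform boundedness on smooth families of test functions -/

/-- A smooth family of functions supported in a fixed compact set has uniformly bounded derivatives
as the parameter runs through a compact set. -/
lemma exists_bound_iteratedFDeriv_slice {E G : Type*} [NormedAddCommGroup E] [NormedSpace ℝ E]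
    [NormedAddCommGroup G] [NormedSpace ℝ G] {Ψ : E × G → ℂ} (hΨ : ContDiff ℝ ∞ Ψ) {S : Set E}
    (hS : IsCompact S) {K : Set G} (hK : IsCompact K)
    (hsupp : ∀ p ∈ S, ∀ x ∉ K, Ψ (p, x) = 0) (n : ℕ) :
    ∃ C : ℝ, ∀ p ∈ S, ∀ x, ‖iteratedFDeriv ℝ n (fun y => Ψ (p, y)) x‖ ≤ C := by
  obtain ⟨C, hC⟩ := (hS.prod hK).exists_bound_of_continuousOn
    (hΨ.continuous_iteratedFDeriv (m := n) (by exact_mod_cast le_top)).continuousOn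
  refine ⟨max C 0, fun p hp x => ?_⟩
  by_cases hx : x ∈ K
  · have h1 : (fun y => Ψ (p, y)) =
        (fun z => Ψ ((p, 0) + z)) ∘ ContinuousLinearMap.inr ℝ E G := by
      funext y; simp
    have h2 : ContDiff ℝ ∞ fun z => Ψ ((p, 0) + z) := hΨ.comp (contDiff_const.add contDiff_id)
    rw [h1, ContinuousLinearMap.iteratedFDeriv_comp_right _ h2 x (by exact_mod_cast le_top)]
    refine (ContinuousMultilinearMap.norm_compContinuousLinearMap_le _ _).trans ?_
    rw [iteratedFDeriv_comp_add_left]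
    have h3 : ∏ _i : Fin n, ‖ContinuousLinearMap.inr ℝ E G‖ ≤ 1 :=
      Finset.prod_le_one (fun _ _ => norm_nonneg _) fun _ _ =>
        ContinuousLinearMap.norm_inr_le_one ℝ E G
    refine (mul_le_of_le_one_right (norm_nonneg _) h3).trans ((le_max_left C 0).trans' ?_)
    simpa using hC (p, x) ⟨hp, hx⟩
  · have h1 : (fun y => Ψ (p, y)) =ᶠ[𝓝 x] fun _ => 0 := by
      filter_upwards [hK.isClosed.isOpen_compl.mem_nhds hx] with y hy using hsupp p hp y hy
    rw [(h1.iteratedFDeriv ℝ n).eq_of_nhds]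
    simp

lemma continuous_mul_of_tsupport_subset {X : Type*} [TopologicalSpace X] {Ω : Set X}
    (hΩ : IsOpen Ω) {v ψ : X → ℂ} (hv : ContinuousOn v Ω) (hψ : Continuous ψ)
    (hsupp : tsupport ψ ⊆ Ω) : Continuous fun x => v x * ψ x := by
  rw [continuous_iff_continuousAt]
  intro x
  by_cases hx : x ∈ Ω
  · exact ((hv x hx).continuousAt (hΩ.mem_nhds hx)).mul hψ.continuousAt
  · refine continuousAt_const (y := (0 : ℂ)) |>.congr ?_
    filter_upwards [(isClosed_tsupport _).isOpen_compl.mem_nhds fun h => hx (hsupp h)] with y hy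
    simp [image_eq_zero_of_notMem_tsupport hy]

/-- The superposition `x ↦ ∑ c k * Ψ (p k, x)` of a smooth family of test functions, with summable
coefficients. -/
def superposition {E : Type*} [NormedAddCommGroup E] [NormedSpace ℝ E] {d : ℕ} {Ω : Opens (Rd d)}
    {Ψ : E × Rd d → ℂ} (hΨ : ContDiff ℝ ∞ Ψ) {S : Set E} (hS : IsCompact S) {K : Set (Rd d)}
    (hK : IsCompact K) (hKΩ : K ⊆ Ω) (hsupp : ∀ p ∈ S, ∀ x ∉ K, Ψ (p, x) = 0)
    {p : ℕ → E} (hp : ∀ k, p k ∈ S) {c : ℕ → ℂ} (hc : Summable fun k => ‖c k‖) : 𝓓(Ω, ℂ) where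
  toFun x := ∑' k, c k * Ψ (p k, x)
  contDiff' := by
    choose C hC using exists_bound_iteratedFDeriv_slice hΨ hS hK hsupp
    have hs : ∀ k, ContDiff ℝ ∞ fun x => Ψ (p k, x) := fun k =>
      hΨ.comp (contDiff_const.prodMk contDiff_id)
    refine contDiff_tsum (v := fun n k => ‖c k‖ * C n) (fun k => contDiff_const.mul (hs k))
      (fun n _ => hc.mul_right _) fun n k x _ => ?_
    have : iteratedFDeriv ℝ n (fun x => c k * Ψ (p k, x)) x =
        c k • iteratedFDeriv ℝ n (fun x => Ψ (p k, x)) x :=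
      iteratedFDeriv_const_smul_apply (a := c k) (f := fun x => Ψ (p k, x))
        ((hs k).of_le (by exact_mod_cast le_top)).contDiffAt
    rw [this, norm_smul]
    gcongr
    exact hC n _ (hp k) x
  hasCompactSupport' := HasCompactSupport.intro hK fun x hx => by
    simp [hsupp _ (hp _) x hx]
  tsupport_subset' := (closure_minimal (fun x hx => by
    by_contra h
    exact hx (by simp [hsupp _ (hp _) x h])) hK.isClosed).trans hKΩ

lemma superposition_apply {E : Type*} [NormedAddCommGroup E] [NormedSpace ℝ E] {d : ℕ}
    {Ω : Opens (Rd d)} {Ψ : E × Rd d → ℂ} (hΨ : ContDiff ℝ ∞ Ψ) {S : Set E} (hS : IsCompact S)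
    {K : Set (Rd d)} (hK : IsCompact K) (hKΩ : K ⊆ Ω) (hsupp : ∀ p ∈ S, ∀ x ∉ K, Ψ (p, x) = 0)
    {p : ℕ → E} (hp : ∀ k, p k ∈ S) {c : ℕ → ℂ} (hc : Summable fun k => ‖c k‖) (x : Rd d) :
    superposition hΨ hS hK hKΩ hsupp hp hc x = ∑' k, c k * Ψ (p k, x) := rfl

/-- Uniform boundedness principle for distributions given by continuous densities: functionals that
are bounded at each test function are bounded uniformly on a smooth family of test functions
with parameters in a compact set. Banach–Steinhaus is applied on `ℓ¹`, whose elements are the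
coefficients of superpositions of members of the family. -/
lemma exists_bound_of_smooth_family {ι E : Type*} [NormedAddCommGroup E] [NormedSpace ℝ E] {d : ℕ}
    {Ω : Opens (Rd d)} {V : ι → Rd d → ℂ} (hV : ∀ i, ContinuousOn (V i) Ω)
    (hbdd : ∀ φ : 𝓓(Ω, ℂ), ∃ C : ℝ, ∀ i, ‖∫ x, V i x * φ x‖ ≤ C)
    {Ψ : E × Rd d → ℂ} (hΨ : ContDiff ℝ ∞ Ψ) {S : Set E} (hS : IsCompact S) {K : Set (Rd d)}
    (hK : IsCompact K) (hKΩ : K ⊆ Ω) (hsupp : ∀ p ∈ S, ∀ x ∉ K, Ψ (p, x) = 0) :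
    ∃ C : ℝ, ∀ i, ∀ p ∈ S, ‖∫ x, V i x * Ψ (p, x)‖ ≤ C := by
  by_contra! hcon
  -- `p k` is a member of the family on which the functional `i k` exceeds `k`.
  choose i p hp hlt using fun k : ℕ => hcon k
  obtain ⟨M, hM⟩ := exists_bound_iteratedFDeriv_slice hΨ hS hK hsupp 0
  simp only [norm_iteratedFDeriv_zero] at hM
  have hM0 : 0 ≤ M := (norm_nonneg _).trans (hM (p 0) (hp 0) 0)
  have hVint : ∀ i, IntegrableOn (V i) K := fun i => ((hV i).mono hKΩ).integrableOn_compact hK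
  have hcont : ∀ i k, Continuous fun x => V i x * Ψ (p k, x) := fun i k =>
    continuous_mul_of_tsupport_subset Ω.isOpen (hV i)
      (hΨ.continuous.comp (by fun_prop)) ((closure_minimal (fun x hx => by
        by_contra h
        exact hx (hsupp _ (hp k) x h)) hK.isClosed).trans hKΩ)
  have hset : ∀ i (ψ : Rd d → ℂ), (∀ x ∉ K, ψ x = 0) →
      ∫ x, V i x * ψ x = ∫ x in K, V i x * ψ x := fun i ψ h =>
    (setIntegral_eq_integral_of_forall_compl_eq_zero fun x hx => by simp [h x hx]).symm
  have hle : ∀ i k x, ‖V i x * Ψ (p k, x)‖ ≤ ‖V i x‖ * M := fun i k x => by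
    rw [norm_mul]
    gcongr
    exact hM _ (hp k) x
  set B : ι → ℝ := fun i => ∫ x in K, ‖V i x‖ * M with hB
  have hBa : ∀ i k, ‖∫ x, V i x * Ψ (p k, x)‖ ≤ B i := fun i k => by
    rw [hset i _ (hsupp _ (hp k))]
    exact norm_integral_le_of_norm_le ((hVint i).norm.mul_const M)
      (Eventually.of_forall fun x => hle i k x)
  have hsum : ∀ c : lp (fun _ : ℕ => ℂ) 1, Summable fun k => ‖c k‖ := fun c => by
    simpa using (lp.memℓp c).summable (by simp)
  have hnorm : ∀ c : lp (fun _ : ℕ => ℂ) 1, ‖c‖ = ∑' k, ‖c k‖ := fun c => by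
    simpa using lp.norm_eq_tsum_rpow (by simp) c
  have hsumB : ∀ (i : ι) (c : lp (fun _ : ℕ => ℂ) 1),
      Summable fun k => ‖c k * ∫ x, V i x * Ψ (p k, x)‖ := fun i c =>
    ((hsum c).mul_right (B i)).of_nonneg_of_le (fun _ => norm_nonneg _) fun k => by
      rw [norm_mul]
      gcongr
      exact hBa i k
  set T : ι → (lp (fun _ : ℕ => ℂ) 1 →L[ℂ] ℂ) := fun i =>
    LinearMap.mkContinuous
      { toFun := fun c => ∑' k, c k * ∫ x, V i x * Ψ (p k, x)
        map_add' := fun b c => by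
          simp only [lp.coeFn_add, Pi.add_apply, add_mul]
          exact (hsumB i b).of_norm.tsum_add (hsumB i c).of_norm
        map_smul' := fun a c => by
          simp only [lp.coeFn_smul, Pi.smul_apply, smul_eq_mul, RingHom.id_apply, mul_assoc]
          exact tsum_mul_left }
      (B i) (fun c => by
        rw [hnorm, ← tsum_mul_left]
        refine (norm_tsum_le_tsum_norm (hsumB i c)).trans
          ((hsumB i c).tsum_le_tsum (fun k => ?_) ((hsum c).mul_left _))
        rw [norm_mul, mul_comm]
        gcongr
        exact hBa i k) with hT
  have hTapply : ∀ i c, T i c = ∑' k, c k * ∫ x, V i x * Ψ (p k, x) := fun i c => rfl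
  obtain ⟨C, hC⟩ := banach_steinhaus (g := T) fun c => by
    obtain ⟨C, hC⟩ := hbdd (superposition hΨ hS hK hKΩ hsupp hp (hsum c))
    refine ⟨C, fun i => (le_of_eq ?_).trans (hC i)⟩
    congr 1
    rw [hTapply, hset i _ fun x hx => by simp [superposition_apply, hsupp _ (hp _) x hx]]
    simp only [superposition_apply]
    -- Termwise integration of the superposition.
    have hI : ∀ k, Integrable (fun x => c k * (V i x * Ψ (p k, x))) (volume.restrict K) :=
      fun k => ((hcont i k).continuousOn.integrableOn_compact hK).const_mul _
    have := integral_tsum_of_summable_integral_norm (μ := volume.restrict K) hI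
      (((hsum c).mul_right (B i)).of_nonneg_of_le
        (fun _ => integral_nonneg fun _ => norm_nonneg _) fun k => by
          simp only [norm_mul (c k)]
          rw [integral_const_mul]
          gcongr
          exact integral_mono_of_nonneg (Eventually.of_forall fun _ => norm_nonneg _)
            ((hVint i).norm.mul_const M) (Eventually.of_forall fun x => hle i k x))
    simp only [integral_const_mul] at this
    calc ∑' k, c k * ∫ x, V i x * Ψ (p k, x)
        = ∑' k, c k * ∫ x in K, V i x * Ψ (p k, x) :=
          tsum_congr fun k => by rw [hset i _ (hsupp _ (hp k))]
      _ = ∫ x in K, ∑' k, c k * (V i x * Ψ (p k, x)) := this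
      _ = ∫ x in K, V i x * ∑' k, c k * Ψ (p k, x) := by
          refine integral_congr_ae (Eventually.of_forall fun x => ?_)
          simp only [← tsum_mul_left]
          exact tsum_congr fun k => by ring
  -- The `k`-th unit vector of `ℓ¹` recovers the member `p k`.
  obtain ⟨k, hk⟩ := exists_nat_ge C
  have h1 : T (i k) (lp.single 1 k 1) = ∫ x, V (i k) x * Ψ (p k, x) := by
    rw [hTapply, tsum_eq_single k]
    · simp
    · intro j hj
      simp [hj]
  have h2 := (T (i k)).le_of_opNorm_le (hC (i k)) (lp.single 1 k 1)
  rw [h1, lp.norm_single (by simp), norm_one, mul_one] at h2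
  exact absurd (hlt k) (not_lt.2 (h2.trans hk))

/-! ### Uniformity in the dilation -/

section Dilation

variable {d : ℕ} {ι E : Type*} [NormedAddCommGroup E] [NormedSpace ℝ E]

lemma integral_dilation_mul (V ψ : Rd d → ℂ) (s : ℝ) :
    ∫ x, V (Real.exp s • x) * ψ x =
      (Real.exp (-(d * s)) : ℂ) * ∫ x, V x * ψ (Real.exp (-s) • x) := by
  have h := Measure.integral_comp_smul (volume : Measure (Rd d))
    (fun x => V x * ψ (Real.exp (-s) • x)) (Real.exp s)
  simp only [smul_smul, ← Real.exp_add, neg_add_cancel, Real.exp_zero, one_smul] at h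
  rw [h, finrank_euclideanSpace_fin, ← Real.exp_nat_mul, ← Real.exp_neg,
    abs_of_pos (Real.exp_pos _), Complex.real_smul, Complex.ofReal_exp]

lemma continuous_dilation_mul {U : Rd d → ℂ} (hU : ContinuousOn U (punctured d)) {θ : Rd d → ℂ}
    (hθ : Continuous θ) {K : Set (Rd d)} (hK : IsCompact K) (hKΩ : K ⊆ punctured d)
    (hsupp : ∀ x ∉ K, θ x = 0) :
    Continuous fun p : ℝ × Rd d => U (Real.exp p.1 • p.2) * θ p.2 := by
  refine continuous_mul_of_tsupport_subset (Ω := univ ×ˢ (punctured d : Set (Rd d)))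
    (isOpen_univ.prod (punctured d).isOpen) ?_ (by fun_prop) ?_
  · exact hU.comp (by fun_prop) fun p hp => smul_ne_zero (Real.exp_pos _).ne' hp.2
  · refine (closure_minimal (fun p hp => ?_) (isClosed_univ.prod hK.isClosed)).trans
      (prod_mono_right hKΩ)
    by_contra h
    exact hp (hsupp p.2 fun h' => h ⟨trivial, h'⟩)

lemma integrable_dilation_mul {U : Rd d → ℂ} (hU : ContinuousOn U (punctured d)) {θ : Rd d → ℂ}
    (hθ : Continuous θ) {K : Set (Rd d)} (hK : IsCompact K) (hKΩ : K ⊆ punctured d)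
    (hsupp : ∀ x ∉ K, θ x = 0) (t : ℝ) :
    Integrable fun x : Rd d => U (Real.exp t • x) * θ x :=
  ((continuous_dilation_mul hU hθ hK hKΩ hsupp).comp
    (Continuous.prodMk_right t)).integrable_of_hasCompactSupport
    (HasCompactSupport.intro hK fun x hx => by simp [hsupp x hx])

/-- If weak homogeneity of degree `α` holds up to a bounded error for each dilation and each test
function, then the error is bounded uniformly for dilations in compact intervals and test
functions in a smooth compact family. -/
theorem exists_bound_dilation (α : ℝ) {U : ι → Rd d → ℂ}
    (hU : ∀ i, ContinuousOn (U i) (punctured d))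
    (hom : ∀ c : ℝ, 0 < c → ∀ φ : 𝓓(punctured d, ℂ),
      ∃ C : ℝ, ∀ i, ‖∫ x, (U i (c • x) - ((c ^ α : ℝ) : ℂ) * U i x) * φ x‖ ≤ C)
    {Θ : E × Rd d → ℂ} (hΘ : ContDiff ℝ ∞ Θ) {S : Set E} (hS : IsCompact S) {K : Set (Rd d)}
    (hK : IsCompact K) (hKΩ : K ⊆ punctured d) (hsupp : ∀ p ∈ S, ∀ x ∉ K, Θ (p, x) = 0)
    {a b : ℝ} (ha : 0 < a) :
    ∃ C : ℝ, ∀ i, ∀ p ∈ S, ∀ r ∈ Icc a b,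
      ‖∫ x, (U i (r • x) / ((r ^ α : ℝ) : ℂ) - U i x) * Θ (p, x)‖ ≤ C := by
  have hΘc : ∀ p, Continuous fun x => Θ (p, x) := fun p => hΘ.continuous.comp (by fun_prop)
  have hint : ∀ i, ∀ p ∈ S, ∀ t : ℝ, Integrable fun x => U i (Real.exp t • x) * Θ (p, x) :=
    fun i p hp t => integrable_dilation_mul (hU i) (hΘc p) hK hKΩ (hsupp p hp) t
  set H : ι → E → ℝ → ℂ := fun i p t =>
    (Real.exp (-(α * t)) : ℂ) * ∫ x, U i (Real.exp t • x) * Θ (p, x) with hH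
  have hHc : ∀ i, ∀ p ∈ S, Continuous (H i p) := fun i p hp => by
    have h : ContinuousOn (fun t : ℝ => ∫ x, U i (Real.exp t • x) * Θ (p, x)) univ :=
      continuousOn_integral_of_compact_support hK
        (continuous_dilation_mul (hU i) (hΘc p) hK hKΩ (hsupp p hp)).continuousOn
        fun t x _ hx => by simp [hsupp p hp x hx]
    exact (by fun_prop : Continuous fun t : ℝ => ((Real.exp (-(α * t)) : ℝ) : ℂ)).mul
      (continuousOn_univ.1 h)
  have hincr : ∀ R t : ℝ, ∃ C : ℝ, ∀ i, ∀ p ∈ S, ∀ s, |s| ≤ R →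
      ‖H i p (s + t) - H i p s‖ ≤ C := by
    intro R t
    -- The increment with step `t` tests the error of the dilation by `exp t` on rescaled test
    -- functions, which again form a smooth compact family.
    set V : ι → Rd d → ℂ := fun i x =>
      U i (Real.exp t • x) - ((Real.exp t ^ α : ℝ) : ℂ) * U i x with hV
    have hVc : ∀ i, ContinuousOn (V i) (punctured d) := fun i =>
      ((hU i).comp (by fun_prop) (mapsTo_smul_punctured (Real.exp_pos t))).sub
        (continuousOn_const.mul (hU i))
    set Ψ : (ℝ × E) × Rd d → ℂ := fun q =>
      ((Real.exp (-(α * q.1.1) + -(d * q.1.1)) : ℝ) : ℂ) *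
        Θ (q.1.2, Real.exp (-q.1.1) • q.2) with hΨ
    have hΨs : ContDiff ℝ ∞ Ψ := by
      refine (Complex.ofRealCLM.contDiff.comp (g := Complex.ofRealCLM)
        (f := fun q : (ℝ × E) × Rd d => Real.exp (-(α * q.1.1) + -(d * q.1.1)))
        (by fun_prop)).mul (hΘ.comp ?_)
      fun_prop
    obtain ⟨C, hC⟩ := exists_bound_of_smooth_family hVc (hom _ (Real.exp_pos t)) hΨs
      ((isCompact_Icc (a := -R) (b := R)).prod hS)
      (K := (fun p : ℝ × Rd d => Real.exp p.1 • p.2) '' (Icc (-R) R ×ˢ K))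
      ((isCompact_Icc.prod hK).image (by fun_prop))
      (by
        rintro _ ⟨p, hp, rfl⟩
        exact smul_ne_zero (Real.exp_pos _).ne' (mem_punctured.1 (hKΩ hp.2)))
      (by
        rintro ⟨s, p⟩ ⟨hs, hp⟩ x hx
        have : Real.exp (-s) • x ∉ K := fun h => hx ⟨(s, Real.exp (-s) • x), ⟨hs, h⟩, by
          simp [smul_smul, ← Real.exp_add]⟩
        simp [hΨ, hsupp p hp _ this])
    refine ⟨Real.exp (-(α * t)) * C, fun i p hp s hs => ?_⟩
    have key : H i p (s + t) - H i p s =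
        ((Real.exp (-(α * t)) : ℝ) : ℂ) * ∫ x, V i x * Ψ ((s, p), x) := by
      have h1 : ∫ x, V i (Real.exp s • x) * Θ (p, x) =
          (∫ x, U i (Real.exp (s + t) • x) * Θ (p, x)) -
            (Real.exp (α * t) : ℂ) * ∫ x, U i (Real.exp s • x) * Θ (p, x) := by
        rw [← integral_const_mul, ← integral_sub (hint i p hp _) ((hint i p hp _).const_mul _)]
        refine integral_congr_ae (Eventually.of_forall fun x => ?_)
        simp only [hV, smul_smul, ← Real.exp_add, ← Real.exp_mul]
        rw [add_comm t s, mul_comm t α]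
        push_cast
        ring
      have h2 : ∫ x, V i x * Ψ ((s, p), x) =
          (Real.exp (-(α * s)) : ℂ) * ∫ x, V i (Real.exp s • x) * Θ (p, x) := by
        rw [integral_dilation_mul, ← mul_assoc, ← integral_const_mul]
        refine integral_congr_ae (Eventually.of_forall fun x => ?_)
        simp only [hΨ, Real.exp_add]
        push_cast
        ring
      rw [h2, h1]
      simp only [hH]
      have h3 : (Real.exp (-(α * (s + t))) : ℂ) =
          (Real.exp (-(α * t)) : ℂ) * (Real.exp (-(α * s)) : ℂ) := by
        rw [← Complex.ofReal_mul, ← Real.exp_add]; congr 2; ring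
      have h4 : (Real.exp (-(α * t)) : ℂ) * (Real.exp (α * t) : ℂ) = 1 := by
        rw [← Complex.ofReal_mul, ← Real.exp_add]; simp
      rw [h3]
      linear_combination ((Real.exp (-(α * s)) : ℂ) *
        ∫ x, U i (Real.exp s • x) * Θ (p, x)) * h4
    rw [key, norm_mul, Complex.norm_real, Real.norm_eq_abs, abs_of_pos (Real.exp_pos _)]
    gcongr
    exact hC i (s, p) ⟨abs_le.1 hs, hp⟩
  obtain ⟨C, hC⟩ := exists_bound_of_increments hHc hincr (max |Real.log a| |Real.log b|)
  refine ⟨C, fun i p hp r hr => ?_⟩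
  have hr0 : 0 < r := ha.trans_le hr.1
  have hlog : |Real.log r| ≤ max |Real.log a| |Real.log b| :=
    abs_le_max_abs_abs (Real.log_le_log ha hr.1) (Real.log_le_log hr0 hr.2)
  refine (le_of_eq ?_).trans (hC i p hp _ hlog)
  congr 1
  simp only [hH]
  rw [← integral_const_mul, ← integral_const_mul,
    ← integral_sub ((hint i p hp _).const_mul _) ((hint i p hp _).const_mul _)]
  refine integral_congr_ae (Eventually.of_forall fun x => ?_)
  simp only [Real.exp_log hr0, mul_zero, neg_zero, Real.exp_zero, one_smul]
  rw [Real.rpow_def_of_pos hr0, mul_comm (Real.log r) α, Real.exp_neg]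
  push_cast
  ring

end Dilation

/-! ### The radial mean in polar form -/

section Radial

variable {d : ℕ}

lemma exists_norm_bounds {K : Set (Rd d)} (hK : IsCompact K) (hKΩ : K ⊆ punctured d) :
    ∃ l M : ℝ, 0 < l ∧ 0 < M ∧ ∀ x ∈ K, l ≤ ‖x‖ ∧ ‖x‖ ≤ M := by
  have h0 : ∀ x ∈ K, 0 < ‖x‖ := fun x hx => norm_pos_iff.2 (mem_punctured.1 (hKΩ hx))
  obtain ⟨M, hM⟩ := hK.exists_bound_of_continuousOn (f := fun x => ‖x‖) (by fun_prop)
  obtain ⟨L, hL⟩ := hK.exists_bound_of_continuousOn (f := fun x => ‖x‖⁻¹)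
    (continuous_norm.continuousOn.inv₀ fun x hx => (h0 x hx).ne')
  refine ⟨(max L 1)⁻¹, max M 1, by positivity, by positivity, fun x hx => ⟨?_, ?_⟩⟩
  · have := hL x hx
    rw [norm_inv, norm_norm] at this
    exact (inv_le_comm₀ (h0 x hx) (by positivity)).1 (this.trans (le_max_left _ _))
  · have := hM x hx
    rw [norm_norm] at this
    exact this.trans (le_max_left _ _)

/-- The smooth family `ρ ↦ φ(x) |x| w(ρ |x|)`. Its integral over `ρ > 0` is `φ(x) ∫ w`, and the
substitution `r = ρ |x|` writes the radial mean in polar form as an average over `ρ` of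
dilations tested on this family. -/
def radialFamily (w : 𝓓(posReals, ℂ)) (φ : 𝓓(punctured d, ℂ)) (p : ℝ × Rd d) : ℂ :=
  φ p.2 * ((‖p.2‖ : ℂ) * w (p.1 * ‖p.2‖))

lemma contDiff_radialFamily (w : 𝓓(posReals, ℂ)) (φ : 𝓓(punctured d, ℂ)) :
    ContDiff ℝ ∞ (radialFamily w φ) := by
  rw [contDiff_iff_contDiffAt]
  rintro ⟨ρ, x⟩
  by_cases hx : x = 0
  · have h : (tsupport φ)ᶜ ∈ 𝓝 x :=
      (isClosed_tsupport _).isOpen_compl.mem_nhds fun h => φ.tsupport_subset h hx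
    refine (contDiffAt_const (c := (0 : ℂ))).congr_of_eventuallyEq ?_
    filter_upwards [continuous_snd.continuousAt.preimage_mem_nhds h] with p hp
    simp [radialFamily, image_eq_zero_of_notMem_tsupport hp]
  · have hn : ContDiffAt ℝ ∞ (fun p : ℝ × Rd d => ‖p.2‖) (ρ, x) :=
      (contDiffAt_norm ℝ hx).comp (ρ, x) contDiffAt_snd
    exact (φ.contDiff.contDiffAt.comp (ρ, x) contDiffAt_snd).mul
      ((Complex.ofRealCLM.contDiff.contDiffAt.comp (ρ, x) hn).mul
        (w.contDiff.contDiffAt.comp (ρ, x) (contDiffAt_fst.mul hn)))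

lemma radialIntegral_angular (α : ℝ) (w : 𝓓(posReals, ℂ)) (v : Rd d → ℂ) {x : Rd d}
    (hx : x ≠ 0) :
    radialIntegral α w v (‖x‖⁻¹ • x) * ((‖x‖ ^ α : ℝ) : ℂ) =
      ∫ ρ in Ioi (0 : ℝ), v (ρ • x) / ((ρ ^ α : ℝ) : ℂ) * ((‖x‖ : ℂ) * w (ρ * ‖x‖)) := by
  have hx0 : 0 < ‖x‖ := norm_pos_iff.2 hx
  have h := integral_comp_mul_left_Ioi'
    (fun r : ℝ => v (r • (‖x‖⁻¹ • x)) / ((r ^ α : ℝ) : ℂ) * w r) 0 hx0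
  rw [mul_zero] at h
  rw [radialIntegral, ← h, Complex.real_smul, mul_right_comm, ← integral_const_mul]
  refine setIntegral_congr_fun measurableSet_Ioi fun ρ hρ => ?_
  have h1 : ((‖x‖ ^ α : ℝ) : ℂ) ≠ 0 :=
    Complex.ofReal_ne_zero.2 (Real.rpow_pos_of_pos hx0 α).ne'
  have h2 : ((ρ ^ α : ℝ) : ℂ) ≠ 0 := Complex.ofReal_ne_zero.2 (Real.rpow_pos_of_pos hρ α).ne'
  simp only [smul_smul]
  rw [show ‖x‖ * ρ * ‖x‖⁻¹ = ρ by field_simp, Real.mul_rpow hx0.le (le_of_lt hρ),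
    Complex.ofReal_mul, mul_comm ρ ‖x‖]
  field_simp

lemma integral_radial_weight (w : 𝓓(posReals, ℂ)) {x : Rd d} (hx : x ≠ 0) :
    ∫ ρ in Ioi (0 : ℝ), (‖x‖ : ℂ) * w (ρ * ‖x‖) = ∫ r, w r := by
  have h := integral_comp_mul_left_Ioi' (fun r : ℝ => w r) 0 (norm_pos_iff.2 hx)
  rw [mul_zero] at h
  rw [integral_const_mul, ← Complex.real_smul]
  simp only [mul_comm _ ‖x‖]
  rw [h]
  refine setIntegral_eq_integral_of_forall_compl_eq_zero fun r hr =>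
    image_eq_zero_of_notMem_tsupport fun h => hr (w.tsupport_subset h)

/-- Pointwise form of the defect of the representation formula. Subtracting `v x` under the integral
uses that the weight `|x| w(ρ |x|)` has integral `1` in `ρ`. -/
lemma radialIntegral_angular_sub (α : ℝ) (w : 𝓓(posReals, ℂ)) (hw : ∫ r, w r = 1) {v : Rd d → ℂ}
    (hv : ContinuousOn v (punctured d)) {x : Rd d} (hx : x ≠ 0) {a b : ℝ} (ha : 0 < a)
    (hwI : ∀ ρ ∈ Ioi (0 : ℝ) \ Icc a b, w (ρ * ‖x‖) = 0) :
    radialIntegral α w v (‖x‖⁻¹ • x) * ((‖x‖ ^ α : ℝ) : ℂ) - v x =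
      ∫ ρ in Icc a b, (v (ρ • x) / ((ρ ^ α : ℝ) : ℂ) - v x) * ((‖x‖ : ℂ) * w (ρ * ‖x‖)) := by
  have hI0 : ∀ ρ ∈ Icc a b, 0 < ρ := fun ρ hρ => ha.trans_le hρ.1
  have hIoi : ∀ G : ℝ → ℂ, ∫ ρ in Ioi (0 : ℝ), G ρ * ((‖x‖ : ℂ) * w (ρ * ‖x‖)) =
      ∫ ρ in Icc a b, G ρ * ((‖x‖ : ℂ) * w (ρ * ‖x‖)) := fun G =>
    setIntegral_eq_of_subset_of_forall_sdiff_eq_zero measurableSet_Ioi hI0 fun ρ hρ => by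
      simp [hwI ρ hρ]
  have h2 := hIoi fun _ => 1
  simp only [one_mul] at h2
  have hc : Continuous fun ρ : ℝ => (‖x‖ : ℂ) * w (ρ * ‖x‖) := by
    have := w.continuous
    fun_prop
  have hq : ContinuousOn (fun ρ : ℝ => v (ρ • x) / ((ρ ^ α : ℝ) : ℂ)) (Icc a b) := by
    refine ContinuousOn.div (hv.comp (by fun_prop) fun ρ hρ =>
      smul_ne_zero (hI0 _ hρ).ne' hx) ?_ fun ρ hρ =>
        Complex.ofReal_ne_zero.2 (Real.rpow_pos_of_pos (hI0 _ hρ) α).ne'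
    exact Complex.continuous_ofReal.comp_continuousOn
      (continuousOn_id.rpow_const fun ρ hρ => Or.inl (hI0 _ hρ).ne')
  have i1 : IntegrableOn (fun ρ : ℝ =>
      v (ρ • x) / ((ρ ^ α : ℝ) : ℂ) * ((‖x‖ : ℂ) * w (ρ * ‖x‖))) (Icc a b) :=
    (hq.mul hc.continuousOn).integrableOn_compact isCompact_Icc
  have i2 := hc.continuousOn.integrableOn_compact (μ := volume) (isCompact_Icc (a := a) (b := b))
  rw [radialIntegral_angular α w v hx, hIoi]
  calc _ = (∫ ρ in Icc a b, v (ρ • x) / ((ρ ^ α : ℝ) : ℂ) * ((‖x‖ : ℂ) * w (ρ * ‖x‖))) -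
        v x * ∫ ρ in Icc a b, (‖x‖ : ℂ) * w (ρ * ‖x‖) := by
        rw [← h2, integral_radial_weight w hx, hw, mul_one]
    _ = _ := by
        rw [← integral_const_mul, ← integral_sub i1 (i2.const_mul _)]
        simp only [sub_mul]

/-- The defect of the representation formula, for a single smooth function `v`, is an integral over
a compact interval of dilations of the defects of homogeneity of `v`. -/
lemma exists_radial_defect (α : ℝ) (w : 𝓓(posReals, ℂ)) (hw : ∫ r, w r = 1)
    (φ : 𝓓(punctured d, ℂ)) :
    ∃ a b : ℝ, 0 < a ∧ ∀ v : Rd d → ℂ, ContDiffOn ℝ ∞ v (punctured d) →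
      Integrable (fun x => radialIntegral α w v (‖x‖⁻¹ • x) * ((‖x‖ ^ α : ℝ) : ℂ) * φ x) →
      (∫ x, radialIntegral α w v (‖x‖⁻¹ • x) * ((‖x‖ ^ α : ℝ) : ℂ) * φ x) - ∫ x, v x * φ x =
        ∫ ρ in Icc a b, ∫ x, (v (ρ • x) / ((ρ ^ α : ℝ) : ℂ) - v x) * radialFamily w φ (ρ, x) := by
  obtain ⟨a, b, ha, -, hsupp⟩ := exists_support_bounds w
  have hK : IsCompact (tsupport φ) := φ.hasCompactSupport
  obtain ⟨l, M, hl, hM, hlM⟩ := exists_norm_bounds hK φ.tsupport_subset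
  have hA : 0 < a / M := by positivity
  -- For `x` in the support of `φ`, `w (ρ * ‖x‖)` vanishes unless `a / M ≤ ρ ≤ b / l`.
  refine ⟨a / M, b / l, hA, fun v hv hint => ?_⟩
  have hI0 : ∀ ρ ∈ Icc (a / M) (b / l), 0 < ρ := fun ρ hρ => hA.trans_le hρ.1
  have hφ0 : ∀ x ∉ tsupport φ, φ x = 0 := fun x hx => image_eq_zero_of_notMem_tsupport hx
  have hwI : ∀ x ∈ tsupport φ, ∀ ρ ∈ Ioi (0 : ℝ) \ Icc (a / M) (b / l), w (ρ * ‖x‖) = 0 := by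
    intro x hx ρ hρ
    refine hsupp _ fun h => hρ.2 ⟨?_, ?_⟩
    · rw [div_le_iff₀ hM]
      exact h.1.trans (mul_le_mul_of_nonneg_left (hlM x hx).2 (le_of_lt hρ.1))
    · rw [le_div_iff₀ hl]
      exact (mul_le_mul_of_nonneg_left (hlM x hx).1 (le_of_lt hρ.1)).trans h.2
  have hq : ContinuousOn (fun q : ℝ × Rd d => v (q.1 • q.2) / ((q.1 ^ α : ℝ) : ℂ))
      (Icc (a / M) (b / l) ×ˢ tsupport φ) := by
    refine ContinuousOn.div (hv.continuousOn.comp (by fun_prop) fun q hq =>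
      smul_ne_zero (hI0 _ hq.1).ne' (mem_punctured.1 (φ.tsupport_subset hq.2))) ?_ fun q hq =>
        Complex.ofReal_ne_zero.2 (Real.rpow_pos_of_pos (hI0 _ hq.1) α).ne'
    exact Complex.continuous_ofReal.comp_continuousOn
      (continuousOn_fst.rpow_const fun q hq => Or.inl (hI0 _ hq.1).ne')
  have hF := (hq.sub ((hv.continuousOn.mono φ.tsupport_subset).comp continuousOn_snd
      fun q hq => hq.2)).mul (contDiff_radialFamily w φ).continuous.continuousOn
  have hFint : Integrable (Function.uncurry fun (ρ : ℝ) (x : Rd d) =>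
      (v (ρ • x) / ((ρ ^ α : ℝ) : ℂ) - v x) * radialFamily w φ (ρ, x))
      ((volume.restrict (Icc (a / M) (b / l))).prod (volume.restrict (tsupport φ))) := by
    rw [Measure.prod_restrict, ← Measure.volume_eq_prod]
    exact hF.integrableOn_compact (isCompact_Icc.prod hK)
  have hset : ∀ G : Rd d → ℂ, (∀ x ∉ tsupport φ, G x = 0) → ∫ x in tsupport φ, G x = ∫ x, G x :=
    fun G h => setIntegral_eq_integral_of_forall_compl_eq_zero h
  have hswap := integral_integral_swap hFint
  rw [← integral_sub hint (integrable_mul_testFunction hv φ),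
    ← hset _ fun x hx => by simp [hφ0 x hx]]
  refine Eq.trans ?_ (hswap.symm.trans ?_)
  · refine setIntegral_congr_fun hK.measurableSet fun x hx => ?_
    have h := radialIntegral_angular_sub α w hw hv.continuousOn
      (mem_punctured.1 (φ.tsupport_subset hx)) hA (hwI x hx)
    rw [← sub_mul, h, ← integral_mul_const]
    congr 1
    funext ρ
    simp only [radialFamily]
    ring
  · congr 1
    funext ρ
    exact hset _ fun x hx => by simp [radialFamily, hφ0 x hx]

/-! ### Weak and strong homogeneity -/

lemma pairing_mk_eq_iff {Ω : Opens (Rd d)} {u v : moderateNets Ω} {φ : 𝓓(Ω, ℂ)} :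
    pairing (Ideal.Quotient.mk (negligibleNets Ω) u) φ =
        pairing (Ideal.Quotient.mk (negligibleNets Ω) v) φ ↔
      ∀ m : ℕ, ∀ᶠ ε in smallEps,
        ‖(∫ x, u.1 ε x * φ x) - ∫ x, v.1 ε x * φ x‖ ≤ (ε : ℝ) ^ m :=
  Ideal.Quotient.eq

/-- The polar form `x ↦ g (x / |x|) |x| ^ α` is strongly homogeneous: its representatives are
homogeneous functions. -/
lemma isStronglyHomogeneous_angular_mul_normPow (α : ℝ) (g : GenFun (punctured d)) :
    IsStronglyHomogeneous α (angular g * normPow d α) := by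
  intro c hc
  obtain ⟨u, rfl⟩ := Ideal.Quotient.mk_surjective g
  refine congrArg (Ideal.Quotient.mk (negligibleNets (punctured d))) (Subtype.ext ?_)
  funext ε x
  change u.1 ε (‖c • x‖⁻¹ • c • x) * ((‖c • x‖ ^ α : ℝ) : ℂ) =
    ((c ^ α : ℝ) : ℂ) * (u.1 ε (‖x‖⁻¹ • x) * ((‖x‖ ^ α : ℝ) : ℂ))
  have h : ‖c • x‖⁻¹ • c • x = ‖x‖⁻¹ • x := by
    rw [norm_smul, Real.norm_eq_abs, abs_of_pos hc, smul_smul, mul_inv_rev, mul_assoc,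
      inv_mul_cancel₀ hc.ne', mul_one]
  rw [h, norm_smul, Real.norm_eq_abs, abs_of_pos hc, Real.mul_rpow hc.le (norm_nonneg x)]
  push_cast
  ring

/-- The representation formula: a weakly homogeneous generalized function pairs with test functions
as the polar form built from its radial mean. The defect, scaled by `ε ^ (-m)` along a sequence of
parameters, is an average of quantities that `exists_bound_dilation` bounds uniformly. -/
theorem pairing_eq_pairing_angular_radialMean (α : ℝ) {f : GenFun (punctured d)}
    (hf : IsWeaklyHomogeneous α f) (w : 𝓓(posReals, ℂ)) (hw : ∫ r, w r = 1)
    (φ : 𝓓(punctured d, ℂ)) :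
    pairing f φ = pairing (angular (radialMean α w f) * normPow d α) φ := by
  obtain ⟨u, rfl⟩ := Ideal.Quotient.mk_surjective f
  obtain ⟨a, b, ha, hdefect⟩ := exists_radial_defect α w hw φ
  have hnorm : ContDiffOn ℝ ∞ (fun x : Rd d => ((‖x‖ ^ α : ℝ) : ℂ)) (punctured d) :=
    Complex.ofRealCLM.contDiff.comp_contDiffOn
      (contDiffOn_norm_punctured.rpow_const_of_ne fun _ hx =>
        norm_ne_zero_iff.2 (mem_punctured.1 hx))
  set P : moderateNets (punctured d) := pullbackNet (fun x => ‖x‖⁻¹ • x)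
    ((contDiffOn_norm_punctured.inv fun _ hx => norm_ne_zero_iff.2 (mem_punctured.1 hx)).smul
      contDiffOn_id)
    (fun _ hx => smul_ne_zero (inv_ne_zero (norm_ne_zero_iff.2 (mem_punctured.1 hx)))
      (mem_punctured.1 hx)) (radialMeanNet α w u) *
    ⟨fun _ x => ((‖x‖ ^ α : ℝ) : ℂ), fun _ => hnorm, isModerate_const_net hnorm⟩ with hP
  have hPapply : ∀ ε x, P.1 ε x =
      radialIntegral α w (u.1 ε) (‖x‖⁻¹ • x) * ((‖x‖ ^ α : ℝ) : ℂ) := fun _ _ => rfl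
  refine Eq.symm ((pairing_mk_eq_iff (u := P) (v := u)).2
    (negligible_of_forall_seq fun m e he => ?_))
  set s : ℕ → ℂ := fun n => ((((e n : ℝ)⁻¹) ^ m : ℝ) : ℂ) with hs
  have hU : ∀ n, ContinuousOn (fun x => s n * u.1 (e n) x) (punctured d) := fun n =>
    continuousOn_const.mul (u.2.1 (e n)).continuousOn
  have hhom : ∀ c : ℝ, 0 < c → ∀ ψ : 𝓓(punctured d, ℂ), ∃ C : ℝ, ∀ n,
      ‖∫ x, (s n * u.1 (e n) (c • x) - ((c ^ α : ℝ) : ℂ) * (s n * u.1 (e n) x)) * ψ x‖ ≤ C := by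
    intro c hc ψ
    have h := (pairing_mk_eq_iff
      (u := pullbackNet (fun x => c • x) (by fun_prop) (mapsTo_smul_punctured hc) u)
      (v := ((c ^ α : ℝ) : ℂ) • u)).1 (hf c hc ψ)
    obtain ⟨C, hC⟩ := exists_bound_seq_of_negligible (h m) he
    refine ⟨C, fun n => (le_of_eq ?_).trans (hC n)⟩
    rw [← integral_sub
      (integrable_mul_testFunction ((pullbackNet _ _ (mapsTo_smul_punctured hc) u).2.1 _) ψ)
      (integrable_mul_testFunction ((((c ^ α : ℝ) : ℂ) • u).2.1 _) ψ), ← integral_const_mul]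
    congr 1
    refine integral_congr_ae (Eventually.of_forall fun x => ?_)
    change _ = s n * (u.1 (e n) (c • x) * ψ x - (((c ^ α : ℝ) : ℂ) * u.1 (e n) x) * ψ x)
    ring
  obtain ⟨C, hC⟩ := exists_bound_dilation α hU hhom (contDiff_radialFamily w φ)
    (isCompact_Icc (a := a) (b := b)) φ.hasCompactSupport φ.tsupport_subset
    (fun ρ _ x hx => by simp [radialFamily, image_eq_zero_of_notMem_tsupport hx])
    (b := b) ha
  refine ⟨C * volume.real (Icc a b), fun n => ?_⟩
  have h := hdefect (u.1 (e n)) (u.2.1 (e n)) (integrable_mul_testFunction (P.2.1 (e n)) φ)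
  simp only [hPapply]
  rw [h, ← integral_const_mul]
  refine norm_setIntegral_le_of_norm_le_const (by simp) fun ρ hρ => ?_
  refine (le_of_eq ?_).trans (hC n ρ hρ ρ hρ)
  rw [← integral_const_mul]
  congr 1
  refine integral_congr_ae (Eventually.of_forall fun x => ?_)
  simp only [hs]
  ring

end Radial

end Colombeau

end

theorem mainTheorem2 (d : ℕ) (α : ℝ)
    (f : Colombeau.GenFun (Colombeau.punctured d)) (hf : Colombeau.IsWeaklyHomogeneous α f)
    (u₀ : 𝓓(Colombeau.posReals, ℂ)) (hu₀ : ∫ r, u₀ r = 1) :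
    (∀ φ : 𝓓(Colombeau.punctured d, ℂ),
      Colombeau.pairing f φ =
        Colombeau.pairing
          (Colombeau.angular (Colombeau.radialMean α u₀ f) * Colombeau.normPow d α) φ) ∧
    ∃ h : Colombeau.GenFun (Colombeau.punctured d),
      Colombeau.IsStronglyHomogeneous α h ∧ Colombeau.EqGenDist f h := by
  have h := Colombeau.pairing_eq_pairing_angular_radialMean α hf u₀ hu₀
  exact ⟨h, _, Colombeau.isStronglyHomogeneous_angular_mul_normPow α _, h⟩
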